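/- Let $M$ be a nondegenerate even lattice of signature $(m,2)$ with pairing $\langle\cdot,\cdot\rangle$, let $M^\vee\subset M\otimes\mathbb{Q}$ be its dual lattice and $D(M)=M^\vee/M$ its discriminant group. Let $\Gamma_M\subset \mathrm{O}(M)$ be the group of isometries acting trivially on $D(M)$, let $$\Omega(M)=\{w\in\mathbb{P}(M\otimes\mathbb{C})\mid \langle w,w\rangle=0,\ \langle w,\overline{w}\rangle<0\},$$ and let $\mathcal{P}_M=\Omega(M)/\Gamma_M$ be the period space, regarded as a complex analytic space (its analytic subsets are the subsets whose preimage in $\Omega(M)$ is analytic). For $\mathbf{v}=(v_1,\dots,v_r)\in(M^\vee)^r$ put $Q(\mathbf{v})=\frac12(\langle v_i,v_j\rangle)_{i,j}$ and $\langle\mathbf{v}\rangle^\perp=\{w\in\Omega(M)\mid\langle v_i,w\rangle=0\text{ for all }i\}$. For $T\in\mathrm{Sym}_r(\mathbb{Q})$ and $\boldsymbol{\gamma}\in D(M)^r$, the special cycle $Z_{T,\boldsymbol{\gamma}}\subset\mathcal{P}_M$ is the image of the union of the sets $\langle\mathbf{v}\rangle^\perp$ over all $\mathbf{v}\in(M^\vee)^r$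 with $Q(\mathbf{v})=T$ and $\mathbf{v}\equiv\boldsymbol{\gamma}$. Let $E_8$ be the positive definite even unimodular lattice of rank $8$ and $U$ the hyperbolic plane. For an even integer $d>0$ put $$\Lambda_d=E_8^{\oplus2}\oplus U^{\oplus2}\oplus\langle d\rangle,\qquad \Lambda_\#=E_8^{\oplus3}\oplus U^{\oplus2},\qquad \mathcal{P}_d=\mathcal{P}_{\Lambda_d},\qquad \mathcal{P}_\#=\mathcal{P}_{\Lambda_\#}.$$ Each isometric embedding $\Lambda_d\hookrightarrow\Lambda_\#$ induces an injection $\Omega(\Lambda_d)\hookrightarrow\Omega(\Lambda_\#)$; every element of $\Gamma_{\Lambda_d}$ extends to an element of $\Gamma_{\Lambda_\#}$ that acts trivially on $\Lambda_d^\perp$, so the embedding induces a map $f_d\colon\mathcal{P}_d\to\mathcal{P}_\#$. **Proposition.** Let $d>0$ be an even integer. Then $\Lambda_d$ admits a primitive embedding into $\Lambda_\#$. For every primitive embedding $\Lambda_d\hookrightarrow\Lambda_\#$ there is a positive definite symmetric matrix $T\in\mathrm{Sym}_7(\mathbb{Q})$ with $$\det(T)=\frac{d}{2^7}$$ such that the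 image $f_d(\mathcal{P}_d)\subset\mathcal{P}_\#$ is an irreducible component of the special cycle $Z_{T,\mathbf{0}}$, that is, $Z_{T,\mathbf{0}}$ is an analytic subset of $\mathcal{P}_\#$ and $f_d(\mathcal{P}_d)$ is maximal among the irreducible analytic subsets of $\mathcal{P}_\#$ contained in $Z_{T,\mathbf{0}}$. -/

import Mathlib

open scoped LinearAlgebra.Projectivization Matrix

noncomputable section

/-- A nondegenerate integral lattice with underlying group `ℤ^ι`, given by its Gram matrix. -/
structure IntLattice (ι : Type) [Fintype ι] [DecidableEq ι] where
  gram : Matrix ι ι ℤ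
  isSymm : gram.IsSymm
  nondegenerate : gram.det ≠ 0

namespace IntLattice

variable {ι κ : Type} [Fintype ι] [DecidableEq ι] [Fintype κ] [DecidableEq κ]

/-- The `R`-bilinear extension of the pairing to `M ⊗ R = R^ι`. -/
def form (M : IntLattice ι) (R : Type) [CommRing R] : LinearMap.BilinForm R (ι → R) :=
  Matrix.toBilin' (M.gram.map (Int.castRingHom R))

/-- The copy of `M` in `M ⊗ ℚ`: the vectors with integral coordinates. -/
def integral (_M : IntLattice ι) : Submodule ℤ (ι → ℚ) :=
  LinearMap.range ((Algebra.linearMap ℤ ℚ).compLeft ι)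

/-- The dual lattice `M^∨`, as a subgroup of `M ⊗ ℚ`. -/
def dual (M : IntLattice ι) : Submodule ℤ (ι → ℚ) :=
  (M.form ℚ).dualSubmodule M.integral

/-- The discriminant group `D(M) = M^∨ / M`. -/
abbrev Discriminant (M : IntLattice ι) : Type :=
  M.dual ⧸ M.integral.submoduleOf M.dual

/-- The linear action of `GL(M)` on `M ⊗ R`. -/
def act (R : Type) [CommRing R] : GL ι ℤ →* LinearMap.GeneralLinearGroup R (ι → R) :=
  (Matrix.GeneralLinearGroup.toLin (n := ι) (R := R)).toMonoidHom.comp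
    (Matrix.GeneralLinearGroup.map (Int.castRingHom R))

theorem act_smul (R : Type) [CommRing R] (g : GL ι ℤ) (x : ι → R) :
    act R g • x = ((g : Matrix ι ι ℤ).map (Int.castRingHom R)) *ᵥ x := by
  rfl

theorem form_apply (M : IntLattice ι) (R : Type) [CommRing R] (x y : ι → R) :
    M.form R x y = x ⬝ᵥ ((M.gram.map (Int.castRingHom R)) *ᵥ y) := by
  simp [form, Matrix.toBilin'_apply']

theorem act_integral (M : IntLattice ι) (g : GL ι ℤ) {v : ι → ℚ} (hv : v ∈ M.integral) :
    act ℚ g • v ∈ M.integral := by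
  obtain ⟨w, rfl⟩ := hv
  refine ⟨(g : Matrix ι ι ℤ) *ᵥ w, ?_⟩
  rw [act_smul]
  exact funext fun i => RingHom.map_mulVec (Int.castRingHom ℚ) (g : Matrix ι ι ℤ) w i

/-- The monodromy group `Γ_M`: the isometries of `M` that act trivially on `D(M)`, that is, such
that `g v - v ∈ M` for all `v ∈ M^∨`. -/
def monodromyGroup (M : IntLattice ι) : Subgroup (GL ι ℤ) where
  carrier := {g | (∀ x y : ι → ℤ, M.form ℤ (act ℤ g • x) (act ℤ g • y) = M.form ℤ x y) ∧
    ∀ v ∈ M.dual, act ℚ g • v - v ∈ M.integral}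
  one_mem' := by simp
  mul_mem' := by
    rintro g h ⟨hg, hg'⟩ ⟨hh, hh'⟩
    refine ⟨fun x y => by simp [mul_smul, hg, hh], fun v hv => ?_⟩
    have e : act ℚ (g * h) • v - v = act ℚ g • (act ℚ h • v - v) + (act ℚ g • v - v) := by
      rw [map_mul, mul_smul, smul_sub]; abel
    rw [e]
    exact add_mem (M.act_integral g (hh' v hv)) (hg' v hv)
  inv_mem' := by
    rintro g ⟨hg, hg'⟩
    refine ⟨fun x y => by rw [← hg]; simp, fun v hv => ?_⟩
    have e : act ℚ g⁻¹ • v - v = - (act ℚ g⁻¹ • (act ℚ g • v - v)) := by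
      rw [smul_sub, map_inv, inv_smul_smul]; abel
    rw [e]
    exact neg_mem (M.act_integral _ (hg' v hv))

/-- The conditions `⟨w, w⟩ = 0` and `⟨w, w̄⟩ < 0` on a vector `w ∈ M ⊗ ℂ`
(the number `⟨w, w̄⟩` is real, since the pairing is symmetric and defined over `ℤ`). -/
def IsPeriod (M : IntLattice ι) (w : ι → ℂ) : Prop :=
  M.form ℂ w w = 0 ∧ (M.form ℂ w (star w)).re < 0

theorem IsPeriod.ne_zero {M : IntLattice ι} {w : ι → ℂ} (h : M.IsPeriod w) : w ≠ 0 := by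
  rintro rfl
  simpa using h.2

theorem IsPeriod.smul {M : IntLattice ι} {w : ι → ℂ} (h : M.IsPeriod w) {c : ℂ} (hc : c ≠ 0) :
    M.IsPeriod (c • w) := by
  refine ⟨by simp [h.1], ?_⟩
  have e : M.form ℂ (c • w) (star (c • w)) = ((Complex.normSq c : ℝ) : ℂ) * M.form ℂ w (star w) := by
    rw [star_smul, map_smul, map_smul, LinearMap.smul_apply, smul_eq_mul, smul_eq_mul, ← mul_assoc,
      Complex.star_def, mul_comm ((starRingEnd ℂ) c), Complex.mul_conj]
  rw [e, Complex.re_ofReal_mul]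
  exact mul_neg_of_pos_of_neg (Complex.normSq_pos.2 hc) h.2

theorem isPeriod_rep {M : IntLattice ι} {w : ι → ℂ} (h0 : w ≠ 0) :
    M.IsPeriod (Projectivization.mk ℂ w h0).rep ↔ M.IsPeriod w := by
  obtain ⟨a, ha⟩ := Projectivization.exists_smul_eq_mk_rep ℂ w h0
  rw [← ha]
  refine ⟨fun h => ?_, fun h => h.smul a.ne_zero⟩
  have := h.smul a⁻¹.ne_zero
  rwa [← Units.smul_def, inv_smul_smul] at this

/-- The period domain `Ω(M) ⊆ ℙ(M ⊗ ℂ)`. -/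
abbrev Omega (M : IntLattice ι) : Type :=
  {p : ℙ ℂ (ι → ℂ) // M.IsPeriod p.rep}

/-- The point `[w]` of the period domain. -/
def Omega.mk {M : IntLattice ι} (w : ι → ℂ) (hw : M.IsPeriod w) : M.Omega :=
  ⟨Projectivization.mk ℂ w hw.ne_zero, (isPeriod_rep hw.ne_zero).2 hw⟩

/-- Two points of `Ω(M)` are equivalent when an element of `Γ_M` maps one to the other. -/
def periodSetoid (M : IntLattice ι) : Setoid M.Omega where
  r p q := ∃ g ∈ M.monodromyGroup, act ℂ g • p.1 = q.1
  iseqv :=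
    { refl := fun p => ⟨1, one_mem _, by simp⟩
      symm := by
        rintro p q ⟨g, hg, h⟩
        exact ⟨g⁻¹, inv_mem hg, by rw [← h, map_inv, inv_smul_smul]⟩
      trans := by
        rintro p q r ⟨g, hg, h⟩ ⟨g', hg', h'⟩
        exact ⟨g' * g, mul_mem hg' hg, by rw [map_mul, mul_smul, h, h']⟩ }

/-- The period space `𝓟_M = Ω(M) / Γ_M`. -/
def PeriodSpace (M : IntLattice ι) : Type :=
  Quotient M.periodSetoid

/-- The quotient map `Ω(M) → 𝓟_M`. -/
def toPeriodSpace (M : IntLattice ι) (p : M.Omega) : M.PeriodSpace :=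
  Quotient.mk M.periodSetoid p

/-! ### Analytic subsets and irreducible components -/

/-- `A ⊆ Ω(M)` is a (closed) analytic subset: near every point of `Ω(M)` it is cut out by finitely
many holomorphic functions (in homogeneous coordinates). -/
def IsAnalyticInOmega (M : IntLattice ι) (A : Set M.Omega) : Prop :=
  ∀ w : ι → ℂ, M.IsPeriod w → ∃ U : Set (ι → ℂ), IsOpen U ∧ w ∈ U ∧
    ∃ (k : ℕ) (f : Fin k → (ι → ℂ) → ℂ), (∀ i, AnalyticOnNhd ℂ (f i) U) ∧
      ∀ (z : ι → ℂ) (hz : M.IsPeriod z), z ∈ U → (Omega.mk z hz ∈ A ↔ ∀ i, f i z = 0)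

/-- The (closed) analytic subsets of the complex analytic quotient space `𝓟_M = Ω(M) / Γ_M`:
the subsets whose preimage in `Ω(M)` is analytic. -/
def IsAnalytic (M : IntLattice ι) (S : Set M.PeriodSpace) : Prop :=
  M.IsAnalyticInOmega (M.toPeriodSpace ⁻¹' S)

/-- An analytic subset is irreducible if it is nonempty and not contained in the union of two
analytic subsets neither of which contains it. -/
def IsIrreducibleAnalytic (M : IntLattice ι) (S : Set M.PeriodSpace) : Prop :=
  M.IsAnalytic S ∧ S.Nonempty ∧
    ∀ A B : Set M.PeriodSpace, M.IsAnalytic A → M.IsAnalytic B → S ⊆ A ∪ B → S ⊆ A ∨ S ⊆ B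

/-- `C` is an irreducible component of the analytic subset `Z`: it is maximal among the irreducible
analytic subsets contained in `Z`. -/
def IsIrreducibleComponent (M : IntLattice ι) (C Z : Set M.PeriodSpace) : Prop :=
  M.IsAnalytic Z ∧ Maximal (fun S => M.IsIrreducibleAnalytic S ∧ S ⊆ Z) C

/-! ### Special cycles -/

/-- The moment matrix `Q(v) = (⟨v_i, v_j⟩ / 2)`. -/
def moment (M : IntLattice ι) {r : ℕ} (v : Fin r → ι → ℚ) : Matrix (Fin r) (Fin r) ℚ :=
  Matrix.of fun i j => M.form ℚ (v i) (v j) / 2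

/-- The subset `⟨v⟩^⊥` of `Ω(M)`. -/
def perp (M : IntLattice ι) {r : ℕ} (v : Fin r → ι → ℚ) : Set M.Omega :=
  {p | ∀ i, M.form ℂ (fun a => (v i a : ℂ)) p.1.rep = 0}

/-- The special cycle `Z_{T,γ}` of moment `T` and residue class `γ ∈ D(M)^r`: the image in `𝓟_M` of
the union of all `⟨v⟩^⊥` with `v ∈ (M^∨)^r`, `Q(v) = T` and `v ≡ γ`. -/
def specialCycle (M : IntLattice ι) {r : ℕ} (T : Matrix (Fin r) (Fin r) ℚ)
    (γ : Fin r → M.Discriminant) : Set M.PeriodSpace :=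
  M.toPeriodSpace '' ⋃ v ∈ {v : Fin r → M.dual |
      M.moment (fun i => (v i : ι → ℚ)) = T ∧ ∀ i, Submodule.Quotient.mk (v i) = γ i},
    M.perp (fun i => (v i : ι → ℚ))

/-! ### Embeddings of lattices and the induced maps of period spaces -/

/-- A primitive embedding `L ↪ M`: an injective isometric homomorphism with torsion-free
cokernel. -/
structure PrimitiveEmbedding (L : IntLattice ι) (M : IntLattice κ) where
  toLinearMap : (ι → ℤ) →ₗ[ℤ] (κ → ℤ)
  injective : Function.Injective toLinearMap
  isometry : ∀ x y, M.form ℤ (toLinearMap x) (toLinearMap y) = L.form ℤ x y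
  primitive : ∀ (n : ℤ) (y : κ → ℤ), n ≠ 0 → n • y ∈ LinearMap.range toLinearMap →
    y ∈ LinearMap.range toLinearMap

namespace PrimitiveEmbedding

variable {L : IntLattice ι} {M : IntLattice κ}

/-- The matrix of an embedding. -/
def mat (j : PrimitiveEmbedding L M) : Matrix κ ι ℤ :=
  LinearMap.toMatrix' j.toLinearMap

/-- The complexification `L ⊗ ℂ → M ⊗ ℂ` of an embedding. -/
def complexify (j : PrimitiveEmbedding L M) : (ι → ℂ) →ₗ[ℂ] (κ → ℂ) :=
  Matrix.toLin' (j.mat.map (Int.castRingHom ℂ))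

theorem complexify_apply (j : PrimitiveEmbedding L M) (x : ι → ℂ) :
    j.complexify x = (j.mat.map (Int.castRingHom ℂ)) *ᵥ x := by
  simp [complexify]

theorem mat_isometry (j : PrimitiveEmbedding L M) : j.matᵀ * M.gram * j.mat = L.gram := by
  ext a b
  have h := j.isometry (Pi.single a 1) (Pi.single b 1)
  have e : ∀ x, j.toLinearMap x = j.mat *ᵥ x := fun x => by
    rw [mat, LinearMap.toMatrix'_mulVec]
  have hc : ∀ {τ : Type} (A : Matrix τ τ ℤ), A.map (Int.castRingHom ℤ) = A := fun A => by
    ext; simp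
  rw [form_apply, form_apply, e, e, hc, hc] at h
  rw [Matrix.mulVec_mulVec, ← Matrix.vecMul_transpose, ← Matrix.dotProduct_mulVec,
    Matrix.mulVec_mulVec, ← Matrix.mul_assoc] at h
  simpa using h

theorem form_complexify (j : PrimitiveEmbedding L M) (x y : ι → ℂ) :
    M.form ℂ (j.complexify x) (j.complexify y) = L.form ℂ x y := by
  rw [form_apply, form_apply, complexify_apply, complexify_apply, ← j.mat_isometry,
    Matrix.mulVec_mulVec, ← Matrix.vecMul_transpose, ← Matrix.dotProduct_mulVec,
    Matrix.mulVec_mulVec, ← Matrix.mul_assoc, Matrix.map_mul, Matrix.map_mul, Matrix.transpose_map]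

theorem star_complexify (j : PrimitiveEmbedding L M) (x : ι → ℂ) :
    star (j.complexify x) = j.complexify (star x) := by
  ext i
  simp [complexify_apply, Matrix.mulVec, dotProduct]

theorem isPeriod_complexify (j : PrimitiveEmbedding L M) {w : ι → ℂ} (hw : L.IsPeriod w) :
    M.IsPeriod (j.complexify w) := by
  refine ⟨by rw [form_complexify]; exact hw.1, ?_⟩
  rw [star_complexify, form_complexify]
  exact hw.2

/-- The map `Ω(L) → Ω(M)` induced by an embedding. -/
def omegaMap (j : PrimitiveEmbedding L M) (p : L.Omega) : M.Omega :=
  Omega.mk (j.complexify p.1.rep) (j.isPeriod_complexify p.2)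

/-- Every element `g` of `Γ_L` extends to an element of `Γ_M`, acting as the identity on the
orthogonal complement of `L`. -/
theorem exists_extension (j : PrimitiveEmbedding L M) {g : GL ι ℤ} (hg : g ∈ L.monodromyGroup) :
    ∃ g' ∈ M.monodromyGroup, (g' : Matrix κ κ ℤ) * j.mat = j.mat * (g : Matrix ι ι ℤ) ∧
      ∀ x : κ → ℤ, (∀ y, M.form ℤ x (j.toLinearMap y) = 0) → act ℤ g' • x = x := by
  obtain ⟨hgi, hgd⟩ := hg
  set c := Int.castRingHom ℚ with hc
  have cinj : Function.Injective c := Int.cast_injective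
  have hcz : ∀ {σ τ : Type} (A : Matrix σ τ ℤ), A.map (Int.castRingHom ℤ) = A := fun A => by
    ext; simp
  -- the rational matrices
  set G : Matrix ι ι ℚ := L.gram.map c with hG
  set H : Matrix κ κ ℚ := M.gram.map c with hH
  set J : Matrix κ ι ℚ := j.mat.map c with hJ
  set g₁ : Matrix ι ι ℚ := (g : Matrix ι ι ℤ).map c with hg₁
  have hGt : Gᵀ = G := by rw [hG, ← Matrix.transpose_map, L.isSymm]
  have hHt : Hᵀ = H := by rw [hH, ← Matrix.transpose_map, M.isSymm]
  have hdet : IsUnit G.det := by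
    have : G.det = c L.gram.det := (RingHom.map_det c L.gram).symm
    rw [this]
    exact isUnit_iff_ne_zero.2 fun h => L.nondegenerate (cinj (by rw [h, map_zero]))
  have hJG : Jᵀ * H * J = G := by
    rw [hG, ← j.mat_isometry, Matrix.map_mul, Matrix.map_mul, Matrix.transpose_map]
  have hgG' : (g : Matrix ι ι ℤ)ᵀ * L.gram * (g : Matrix ι ι ℤ) = L.gram := by
    ext a b
    have h := hgi (Pi.single a 1) (Pi.single b 1)
    rw [form_apply, form_apply, act_smul, act_smul, hcz, hcz, Matrix.mulVec_mulVec,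
      ← Matrix.vecMul_transpose, ← Matrix.dotProduct_mulVec, Matrix.mulVec_mulVec,
      ← Matrix.mul_assoc] at h
    simpa using h
  have hgG : g₁ᵀ * G * g₁ = G := by
    conv_rhs => rw [hG, ← hgG', Matrix.map_mul, Matrix.map_mul, Matrix.transpose_map]
  -- the orthogonal projection
  set P : Matrix ι κ ℚ := G⁻¹ * (Jᵀ * H) with hP
  clear_value P
  have hGP : G * P = Jᵀ * H := by rw [hP, Matrix.mul_nonsing_inv_cancel_left _ _ hdet]
  have hPG : Pᵀ * G = H * J := by
    have := congrArg Matrix.transpose hGP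
    rwa [Matrix.transpose_mul, hGt, Matrix.transpose_mul, hHt, Matrix.transpose_transpose] at this
  have hPJ : P * J = 1 := by
    rw [hP, Matrix.mul_assoc, hJG, Matrix.nonsing_inv_mul _ hdet]
  -- vectors with integral pairings project to the dual lattice
  have hdual : ∀ y : κ → ℚ, (∀ z : κ → ℤ, ∃ n : ℤ, y ⬝ᵥ H *ᵥ (fun i => (z i : ℚ)) = n) →
      P *ᵥ y ∈ L.dual := by
    rintro y hy _ ⟨w, rfl⟩
    obtain ⟨n, hn⟩ := hy (j.mat *ᵥ w)
    have e : (fun i => (((j.mat *ᵥ w) i : ℤ) : ℚ)) = J *ᵥ (fun i => (w i : ℚ)) :=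
      funext fun i => RingHom.map_mulVec c j.mat w i
    refine Submodule.mem_one.2 ⟨n, ?_⟩
    rw [form_apply]
    change (n : ℚ) = (P *ᵥ y) ⬝ᵥ G *ᵥ (fun i => (w i : ℚ))
    rw [← hn, e, ← Matrix.vecMul_transpose P y, ← Matrix.dotProduct_mulVec, Matrix.mulVec_mulVec,
      Matrix.mulVec_mulVec, hPG]
  have hint : ∀ y : κ → ℚ, (∀ z : κ → ℤ, ∃ n : ℤ, y ⬝ᵥ H *ᵥ (fun i => (z i : ℚ)) = n) →
      ∃ w : ι → ℤ, ((g₁ - 1) * P) *ᵥ y = fun i => (w i : ℚ) := by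
    intro y hy
    obtain ⟨w, hw⟩ := hgd _ (hdual y hy)
    refine ⟨w, ?_⟩
    rw [← Matrix.mulVec_mulVec, Matrix.sub_mulVec, Matrix.one_mulVec]
    exact hw.symm
  -- `(g - 1) P` is integral
  have hA : ∃ A : Matrix ι κ ℤ, A.map c = (g₁ - 1) * P := by
    have h : ∀ k : κ, ∃ w : ι → ℤ, ((g₁ - 1) * P) *ᵥ (Pi.single k 1) = fun i => (w i : ℚ) := by
      refine fun k => hint _ fun z => ⟨(M.gram *ᵥ z) k, ?_⟩
      rw [single_one_dotProduct]
      exact (RingHom.map_mulVec c M.gram z k).symm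
    choose w hw using h
    refine ⟨Matrix.of fun i k => w k i, ?_⟩
    ext i k
    have := congrFun (hw k) i
    simpa using this.symm
  obtain ⟨A, hA⟩ := hA
  set E : Matrix κ κ ℤ := 1 + j.mat * A with hE
  have hEc : E.map c = 1 + J * ((g₁ - 1) * P) := by
    rw [hE, Matrix.map_add c (map_add c), Matrix.map_mul, hA, Matrix.map_one c (map_zero c) (map_one c)]
  have hEH : Eᵀ * M.gram * E = M.gram := by
    apply Matrix.map_injective cinj
    dsimp only
    rw [Matrix.map_mul, Matrix.map_mul, Matrix.transpose_map, hEc, ← hH]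
    have e1 : (1 + J * ((g₁ - 1) * P))ᵀ * H * (1 + J * ((g₁ - 1) * P)) =
        H + (H * J) * ((g₁ - 1) * P) + Pᵀ * (g₁ᵀ - 1) * (Jᵀ * H)
          + Pᵀ * (g₁ᵀ - 1) * (Jᵀ * H * J) * ((g₁ - 1) * P) := by
      simp only [Matrix.transpose_add, Matrix.transpose_mul, Matrix.transpose_sub,
        Matrix.transpose_one, Matrix.mul_add, Matrix.add_mul, Matrix.one_mul, Matrix.mul_one,
        Matrix.mul_assoc]
      abel
    have e2 : H + (Pᵀ * G) * ((g₁ - 1) * P) + Pᵀ * (g₁ᵀ - 1) * (G * P)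
          + Pᵀ * (g₁ᵀ - 1) * G * ((g₁ - 1) * P) = H + Pᵀ * (g₁ᵀ * G * g₁ - G) * P := by
      simp only [Matrix.mul_sub, Matrix.sub_mul, Matrix.one_mul, Matrix.mul_one, Matrix.mul_assoc]
      abel
    rw [e1, hJG, ← hGP, ← hPG, e2, hgG, sub_self, Matrix.mul_zero, Matrix.zero_mul, add_zero]
  have hEdet : IsUnit E.det := by
    have h := congrArg Matrix.det hEH
    rw [Matrix.det_mul, Matrix.det_mul, Matrix.det_transpose] at h
    have h2 : E.det * E.det = 1 := by
      apply mul_right_cancel₀ M.nondegenerate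
      linarith
    exact IsUnit.of_mul_eq_one _ h2
  refine ⟨Matrix.GeneralLinearGroup.mk'' E hEdet, ⟨fun x y => ?_, fun v hv => ?_⟩, ?_, fun x hx => ?_⟩
  · rw [form_apply, form_apply, act_smul, act_smul, hcz, hcz, Matrix.mulVec_mulVec,
      ← Matrix.vecMul_transpose, ← Matrix.dotProduct_mulVec, Matrix.mulVec_mulVec,
      ← Matrix.mul_assoc]
    exact congrArg (fun B => x ⬝ᵥ B *ᵥ y) hEH
  · rw [act_smul]
    change E.map c *ᵥ v - v ∈ _
    obtain ⟨w, hw⟩ := hint v fun z => by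
      obtain ⟨n, hn⟩ := Submodule.mem_one.1 (hv (fun i => (z i : ℚ)) ⟨z, rfl⟩)
      refine ⟨n, ?_⟩
      rw [form_apply] at hn
      exact hn.symm
    refine ⟨j.mat *ᵥ w, ?_⟩
    rw [hEc, Matrix.add_mulVec, Matrix.one_mulVec, add_sub_cancel_left, ← Matrix.mulVec_mulVec, hw]
    exact funext fun i => RingHom.map_mulVec c j.mat w i
  · change E * j.mat = j.mat * (g : Matrix ι ι ℤ)
    apply Matrix.map_injective cinj
    dsimp only
    rw [Matrix.map_mul, Matrix.map_mul, hEc, ← hJ, ← hg₁]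
    have : (1 + J * ((g₁ - 1) * P)) * J = J + J * (g₁ - 1) * (P * J) := by
      simp only [Matrix.add_mul, Matrix.one_mul, Matrix.mul_assoc]
    rw [this, hPJ, Matrix.mul_one, Matrix.mul_sub, Matrix.mul_one, add_sub_cancel]
  · rw [act_smul, hcz]
    change E *ᵥ x = x
    have hx0 : j.matᵀ *ᵥ (M.gram *ᵥ x) = 0 := by
      ext a
      have h := hx (Pi.single a 1)
      have e : j.toLinearMap (Pi.single a 1) = j.mat *ᵥ (Pi.single a 1) := by
        rw [mat, LinearMap.toMatrix'_mulVec]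
      rw [form_apply, hcz, e, Matrix.dotProduct_mulVec, Matrix.dotProduct_mulVec,
        ← Matrix.mulVec_transpose, ← Matrix.mulVec_transpose, M.isSymm] at h
      simpa using h
    have hAx : A *ᵥ x = 0 := by
      ext a
      apply cinj
      rw [RingHom.map_mulVec, hA, hP, ← Matrix.mul_assoc, ← Matrix.mulVec_mulVec]
      have : (Jᵀ * H) *ᵥ (c ∘ x) = 0 := by
        rw [hJ, ← Matrix.transpose_map, hH, ← Matrix.map_mul]
        ext b
        have := RingHom.map_mulVec c (j.matᵀ * M.gram) x b
        rw [← this, ← Matrix.mulVec_mulVec, hx0]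
        simp
      rw [this]
      simp
    rw [hE, Matrix.add_mulVec, Matrix.one_mulVec, ← Matrix.mulVec_mulVec, hAx]
    simp

theorem omegaMap_rel (j : PrimitiveEmbedding L M) {p q : L.Omega} (h : L.periodSetoid p q) :
    M.periodSetoid (j.omegaMap p) (j.omegaMap q) := by
  obtain ⟨g, hg, h⟩ := h
  obtain ⟨g', hg', e, -⟩ := j.exists_extension hg
  refine ⟨g', hg', ?_⟩
  have h0 := p.2.ne_zero
  rw [← Projectivization.mk_rep p.1, ← Projectivization.mk_rep q.1, Projectivization.smul_mk,
    Projectivization.mk_eq_mk_iff] at h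
  obtain ⟨a, ha⟩ := h
  change act ℂ g' • Projectivization.mk ℂ _ _ = Projectivization.mk ℂ _ _
  rw [Projectivization.smul_mk, Projectivization.mk_eq_mk_iff]
  refine ⟨a, ?_⟩
  have e' := congrArg (fun B : Matrix κ ι ℤ => B.map (Int.castRingHom ℂ)) e
  rw [Matrix.map_mul, Matrix.map_mul] at e'
  rw [act_smul, complexify_apply j p.1.rep, Matrix.mulVec_mulVec, e', ← Matrix.mulVec_mulVec,
    ← act_smul, ← ha, Units.smul_def, Units.smul_def, ← complexify_apply, map_smul]

/-- The map `𝓟_L → 𝓟_M` induced by an embedding. -/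
def periodMap (j : PrimitiveEmbedding L M) : L.PeriodSpace → M.PeriodSpace :=
  Quotient.map j.omegaMap fun _ _ h => j.omegaMap_rel h

end PrimitiveEmbedding

/-! ### The lattices -/

/-- The Gram matrix of the hyperbolic plane `U`. -/
def gramU : Matrix (Fin 2) (Fin 2) ℤ := !![0, 1; 1, 0]

/-- The Gram matrix of `E₈^{⊕ a} ⊕ U^{⊕ b}`. -/
def gramEU (a b : ℕ) : Matrix ((Fin 8 × Fin a) ⊕ (Fin 2 × Fin b)) ((Fin 8 × Fin a) ⊕ (Fin 2 × Fin b)) ℤ :=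
  Matrix.fromBlocks (Matrix.blockDiagonal fun _ => CartanMatrix.E₈) 0 0
    (Matrix.blockDiagonal fun _ => gramU)

theorem gramEU_isSymm (a b : ℕ) : (gramEU a b).IsSymm := by
  have hU : gramUᵀ = gramU := by decide
  rw [Matrix.IsSymm, gramEU, Matrix.fromBlocks_transpose, Matrix.blockDiagonal_transpose,
    Matrix.blockDiagonal_transpose]
  simp [hU]

theorem gramEU_det (a b : ℕ) : (gramEU a b).det ≠ 0 := by
  have hU : gramU.det = -1 := by simp [gramU, Matrix.det_fin_two]
  rw [gramEU, Matrix.det_fromBlocks_zero₂₁, Matrix.det_blockDiagonal, Matrix.det_blockDiagonal]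
  simp [hU, CartanMatrix.E₈_det]

/-- `Λ_d = E₈^{⊕ 2} ⊕ U^{⊕ 2} ⊕ ⟨d⟩`. -/
def lambdaD (d : ℕ) (hd : 0 < d) : IntLattice (((Fin 8 × Fin 2) ⊕ (Fin 2 × Fin 2)) ⊕ Fin 1) where
  gram := Matrix.fromBlocks (gramEU 2 2) 0 0 !![(d : ℤ)]
  isSymm := Matrix.IsSymm.fromBlocks (gramEU_isSymm 2 2) (by simp) (by ext i j; fin_cases i; fin_cases j; rfl)
  nondegenerate := by
    rw [Matrix.det_fromBlocks_zero₂₁]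
    exact mul_ne_zero (gramEU_det 2 2) (by simp; omega)

/-- `Λ_# = E₈^{⊕ 3} ⊕ U^{⊕ 2}`. -/
def lambdaSharp : IntLattice ((Fin 8 × Fin 3) ⊕ (Fin 2 × Fin 2)) where
  gram := gramEU 3 2
  isSymm := gramEU_isSymm 3 2
  nondegenerate := gramEU_det 3 2

end IntLattice

end

/-! Existence: with `E₈^{⊕ 2} ⊕ U^{⊕ 2}` mapped identically, it remains to place `⟨d⟩` in the third
copy of `E₈`, on a primitive vector of norm `d`. Five pairwise orthogonal roots and the four-square
theorem provide one (`exists_e8Form_eq`).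

The matrix `T`: `Λ_#` is unimodular of rank 28, so the complement of the rank 21 sublattice has a
basis `V` of 7 vectors, and its discriminant is `± d` (`exists_orthogonal_basis`). It is positive
definite, because `Λ_d` already contains a negative definite plane and `Λ_#` has only two negative
directions. Hence its Gram matrix has determinant `d`, and half of it is the required `T`. As the
sublattice is the full complement of `V`, the image of `𝓟_d` is the image of `⟨V⟩^⊥`
(`range_periodMap`).

Analyticity: rational vectors orthogonal to a period lie in a positive definite space, uniformly so
near a given period. With their norms prescribed by `T`, only finitely many lattice tuples matter
locally, so every `Γ`-stable family of tuples of moment `T` gives an analytic subset of `𝓟_#`.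

Irreducibility: one component of `Ω(Λ_d)` is a star-shaped tube domain, and an element of `Γ`
exchanges it with the other component, so the tube domain surjects onto `𝓟_d`. By the identity
theorem and Baire's theorem, a connected domain is not a countable union of proper analytic subsets.

Maximality: let `S` be irreducible between the image `C` and the cycle `Z`. Then `Z = C ∪ B`, where
`B` comes from the tuples whose locus does not lie over `C`. If `S ⊆ B`, then `C ⊆ B`, and the Baire
argument yields a single such tuple `v` orthogonal to the whole tube domain, hence to `Λ_d`. Since
`T` is nondegenerate, `v` is a rational basis of the complement of `Λ_d`, so its locus does lie over
`C`, a contradiction. -/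

noncomputable section

namespace IntLattice

/-! ### The forms of `Λ_d` and `Λ_#` in coordinates -/

/-- The `R`-bilinear extension of the pairing of `E₈`. -/
def e8Form {R : Type} [CommRing R] (x y : Fin 8 → R) : R :=
  x ⬝ᵥ (CartanMatrix.E₈.map (Int.castRingHom R)) *ᵥ y

theorem e8Form_eq {R : Type} [CommRing R] (x y : Fin 8 → R) :
    e8Form x y = x 0 * (2 * y 0 - y 2) + x 1 * (2 * y 1 - y 3) + x 2 * (-y 0 + 2 * y 2 - y 3)
      + x 3 * (-y 1 - y 2 + 2 * y 3 - y 4) + x 4 * (-y 3 + 2 * y 4 - y 5)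
      + x 5 * (-y 4 + 2 * y 5 - y 6) + x 6 * (-y 5 + 2 * y 6 - y 7) + x 7 * (-y 6 + 2 * y 7) := by
  simp [e8Form, CartanMatrix.E₈, dotProduct, Matrix.mulVec, Fin.sum_univ_succ]
  ring

/-- Completion of squares along the Dynkin diagram, eliminating the nodes in order. All pivots are
positive, and their product is the determinant 1. -/
theorem e8Form_self_eq (x : Fin 8 → ℝ) :
    e8Form x x = 2 * (x 0 - x 2 / 2) ^ 2 + 2 * (x 1 - x 3 / 2) ^ 2
      + 3 / 2 * (x 2 - 2 / 3 * x 3) ^ 2 + 5 / 6 * (x 3 - 6 / 5 * x 4) ^ 2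
      + 4 / 5 * (x 4 - 5 / 4 * x 5) ^ 2 + 3 / 4 * (x 5 - 4 / 3 * x 6) ^ 2
      + 2 / 3 * (x 6 - 3 / 2 * x 7) ^ 2 + 1 / 2 * (x 7) ^ 2 := by
  rw [e8Form_eq]; ring

theorem e8Form_self_nonneg (x : Fin 8 → ℝ) : 0 ≤ e8Form x x := by
  rw [e8Form_self_eq]; positivity

theorem eq_zero_of_e8Form_self_eq_zero {x : Fin 8 → ℝ} (h : e8Form x x = 0) : x = 0 := by
  rw [e8Form_self_eq] at h
  -- Every square vanishes; back substitution starts from the one that involves only `x 7`.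
  have h7 : x 7 = 0 := by
    have : x 7 ^ 2 = 0 := le_antisymm (by
      nlinarith [sq_nonneg (x 0 - x 2 / 2), sq_nonneg (x 1 - x 3 / 2), sq_nonneg (x 2 - 2 / 3 * x 3),
        sq_nonneg (x 3 - 6 / 5 * x 4), sq_nonneg (x 4 - 5 / 4 * x 5), sq_nonneg (x 5 - 4 / 3 * x 6),
        sq_nonneg (x 6 - 3 / 2 * x 7)]) (sq_nonneg _)
    simpa using this
  have h6 : x 6 = 0 := by
    have : (x 6 - 3 / 2 * x 7) ^ 2 = 0 := le_antisymm (by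
      nlinarith [sq_nonneg (x 0 - x 2 / 2), sq_nonneg (x 1 - x 3 / 2), sq_nonneg (x 2 - 2 / 3 * x 3),
        sq_nonneg (x 3 - 6 / 5 * x 4), sq_nonneg (x 4 - 5 / 4 * x 5), sq_nonneg (x 5 - 4 / 3 * x 6),
        sq_nonneg (x 7)]) (sq_nonneg _)
    rw [h7] at this; simpa using this
  have h5 : x 5 = 0 := by
    have : (x 5 - 4 / 3 * x 6) ^ 2 = 0 := le_antisymm (by
      nlinarith [sq_nonneg (x 0 - x 2 / 2), sq_nonneg (x 1 - x 3 / 2), sq_nonneg (x 2 - 2 / 3 * x 3),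
        sq_nonneg (x 3 - 6 / 5 * x 4), sq_nonneg (x 4 - 5 / 4 * x 5), sq_nonneg (x 6 - 3 / 2 * x 7),
        sq_nonneg (x 7)]) (sq_nonneg _)
    rw [h6] at this; simpa using this
  have h4 : x 4 = 0 := by
    have : (x 4 - 5 / 4 * x 5) ^ 2 = 0 := le_antisymm (by
      nlinarith [sq_nonneg (x 0 - x 2 / 2), sq_nonneg (x 1 - x 3 / 2), sq_nonneg (x 2 - 2 / 3 * x 3),
        sq_nonneg (x 3 - 6 / 5 * x 4), sq_nonneg (x 5 - 4 / 3 * x 6), sq_nonneg (x 6 - 3 / 2 * x 7),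
        sq_nonneg (x 7)]) (sq_nonneg _)
    rw [h5] at this; simpa using this
  simp only [h4, h5, h6, h7] at h
  have h3 : x 3 = 0 := by
    have : x 3 ^ 2 = 0 := le_antisymm (by
      nlinarith [sq_nonneg (x 0 - x 2 / 2), sq_nonneg (x 1 - x 3 / 2), sq_nonneg (x 2 - 2 / 3 * x 3)])
      (sq_nonneg _)
    simpa using this
  simp only [h3] at h
  have h2 : x 2 = 0 := by
    have : x 2 ^ 2 = 0 := le_antisymm (by
      nlinarith [sq_nonneg (x 0 - x 2 / 2), sq_nonneg (x 1)])
      (sq_nonneg _)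
    simpa using this
  simp only [h2] at h
  have h1 : x 1 = 0 := by
    have : x 1 ^ 2 = 0 := le_antisymm (by nlinarith [sq_nonneg (x 0)]) (sq_nonneg _)
    simpa using this
  have h0 : x 0 = 0 := by
    have : x 0 ^ 2 = 0 := le_antisymm (by nlinarith [sq_nonneg (x 1)]) (sq_nonneg _)
    simpa using this
  ext i
  fin_cases i <;> assumption

theorem gramEU_dotProduct {R : Type} [CommRing R] (a b : ℕ)
    (x y : (Fin 8 × Fin a) ⊕ (Fin 2 × Fin b) → R) :
    x ⬝ᵥ ((gramEU a b).map (Int.castRingHom R)) *ᵥ y =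
      (∑ k, e8Form (fun i => x (.inl (i, k))) (fun i => y (.inl (i, k)))) +
      ∑ k, (x (.inr (0, k)) * y (.inr (1, k)) + x (.inr (1, k)) * y (.inr (0, k))) := by
  simp only [gramEU, dotProduct, Matrix.mulVec, Fintype.sum_sum_type, Fintype.sum_prod_type,
    Matrix.map_apply, Matrix.fromBlocks_apply₁₁, Matrix.fromBlocks_apply₁₂,
    Matrix.fromBlocks_apply₂₁, Matrix.fromBlocks_apply₂₂, Matrix.blockDiagonal_apply,
    Matrix.zero_apply, map_zero, zero_mul, Finset.sum_const_zero, add_zero, zero_add, e8Form]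
  congr 1
  · rw [Finset.sum_comm]
    refine Finset.sum_congr rfl fun k _ => Finset.sum_congr rfl fun i _ => ?_
    simp [apply_ite, ite_mul]
  · simp [apply_ite, ite_mul, Fin.sum_univ_two, gramU, ← Finset.sum_add_distrib]

theorem lambdaSharp_form {R : Type} [CommRing R] (x y : (Fin 8 × Fin 3) ⊕ (Fin 2 × Fin 2) → R) :
    lambdaSharp.form R x y =
      (∑ k, e8Form (fun i => x (.inl (i, k))) (fun i => y (.inl (i, k)))) +
      ∑ k, (x (.inr (0, k)) * y (.inr (1, k)) + x (.inr (1, k)) * y (.inr (0, k))) := by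
  rw [form_apply]; exact gramEU_dotProduct 3 2 x y

theorem lambdaD_form {R : Type} [CommRing R] {d : ℕ} (hd : 0 < d)
    (x y : ((Fin 8 × Fin 2) ⊕ (Fin 2 × Fin 2)) ⊕ Fin 1 → R) :
    (lambdaD d hd).form R x y =
      (∑ k, e8Form (fun i => x (.inl (.inl (i, k)))) (fun i => y (.inl (.inl (i, k))))) +
      (∑ k, (x (.inl (.inr (0, k))) * y (.inl (.inr (1, k))) +
        x (.inl (.inr (1, k))) * y (.inl (.inr (0, k))))) + d * (x (.inr 0) * y (.inr 0)) := by
  rw [form_apply, ← gramEU_dotProduct 2 2 (fun i => x (.inl i)) (fun i => y (.inl i))]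
  simp only [lambdaD, dotProduct, Matrix.mulVec, Fintype.sum_sum_type (α₂ := Fin 1),
    Matrix.map_apply, Matrix.fromBlocks_apply₁₁, Matrix.fromBlocks_apply₁₂,
    Matrix.fromBlocks_apply₂₁, Matrix.fromBlocks_apply₂₂,
    Matrix.zero_apply, map_zero, zero_mul, Finset.sum_const_zero, add_zero, zero_add]
  simp
  ring

/-! ### Lattices of signature `(m, 2)` -/

section Signature

variable {ι : Type} [Fintype ι] [DecidableEq ι]

/-- The form is positive definite on a subspace of codimension at most two. -/
def PosOnCodimTwo (M : IntLattice ι) : Prop :=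
  ∃ l₁ l₂ : (ι → ℝ) →ₗ[ℝ] ℝ, ∀ x, l₁ x = 0 → l₂ x = 0 → x ≠ 0 → 0 < M.form ℝ x x

theorem form_comm (M : IntLattice ι) (R : Type) [CommRing R] (x y : ι → R) :
    M.form R x y = M.form R y x := by
  have h : (M.gram.map (Int.castRingHom R))ᵀ = M.gram.map (Int.castRingHom R) := by
    rw [← Matrix.transpose_map, M.isSymm]
  rw [form_apply, form_apply, Matrix.dotProduct_mulVec, ← Matrix.mulVec_transpose, h,
    dotProduct_comm]

/-- A vector orthogonal to a negative definite plane has positive norm. -/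
theorem PosOnCodimTwo.form_self_pos {M : IntLattice ι} (hM : M.PosOnCodimTwo) {n₁ n₂ x : ι → ℝ}
    (h₁ : M.form ℝ n₁ n₁ < 0) (h₂ : M.form ℝ n₂ n₂ < 0) (h₁₂ : M.form ℝ n₁ n₂ = 0)
    (hx₁ : M.form ℝ x n₁ = 0) (hx₂ : M.form ℝ x n₂ = 0) (hx : x ≠ 0) : 0 < M.form ℝ x x := by
  obtain ⟨l₁, l₂, hl⟩ := hM
  -- Three coefficients against two linear conditions. If `x` had nonpositive norm, this combination
  -- would have nonpositive norm inside the positive definite subspace, so it would be zero. Pairing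
  -- with `n₁` and `n₂` then kills `b` and `c`, which leaves `a • x = 0`.
  obtain ⟨a, b, c, h0, e₁, e₂⟩ : ∃ a b c : ℝ, (a, b, c) ≠ 0 ∧
      l₁ (a • x + b • n₁ + c • n₂) = 0 ∧ l₂ (a • x + b • n₁ + c • n₂) = 0 := by
    let u : (ℝ × ℝ × ℝ) →ₗ[ℝ] (ι → ℝ) := (LinearMap.toSpanSingleton ℝ _ x).coprod
      ((LinearMap.toSpanSingleton ℝ _ n₁).coprod (LinearMap.toSpanSingleton ℝ _ n₂))
    have hk : LinearMap.ker ((l₁.prod l₂).comp u) ≠ ⊥ :=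
      LinearMap.ker_ne_bot_of_finrank_lt (by simp)
    obtain ⟨⟨a, b, c⟩, hv, hv0⟩ := Submodule.exists_mem_ne_zero_of_ne_bot hk
    have hu : u (a, b, c) = a • x + b • n₁ + c • n₂ := by simp [u, add_assoc]
    rw [LinearMap.mem_ker, LinearMap.comp_apply, hu, LinearMap.prod_apply] at hv
    exact ⟨a, b, c, hv0, congrArg Prod.fst hv, congrArg Prod.snd hv⟩
  have e : M.form ℝ (a • x + b • n₁ + c • n₂) (a • x + b • n₁ + c • n₂) =
      a ^ 2 * M.form ℝ x x + b ^ 2 * M.form ℝ n₁ n₁ + c ^ 2 * M.form ℝ n₂ n₂ := by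
    simp only [map_add, map_smul, LinearMap.add_apply, LinearMap.smul_apply, smul_eq_mul,
      M.form_comm ℝ n₁ x, M.form_comm ℝ n₂ x, M.form_comm ℝ n₂ n₁, hx₁, hx₂, h₁₂]
    ring
  by_contra hneg
  push Not at hneg
  have hs : a • x + b • n₁ + c • n₂ = 0 := by
    by_contra hne
    have := hl _ e₁ e₂ hne
    rw [e] at this
    nlinarith [mul_nonneg (sq_nonneg a) (sub_nonneg.2 hneg),
      mul_nonneg (sq_nonneg b) (sub_nonneg.2 h₁.le), mul_nonneg (sq_nonneg c) (sub_nonneg.2 h₂.le)]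
  have hb : b = 0 := by
    have := congrArg (M.form ℝ n₁) hs
    simp only [map_add, map_smul, smul_eq_mul, M.form_comm ℝ n₁ x, hx₁, h₁₂, map_zero, mul_zero,
      zero_add, add_zero] at this
    exact (mul_eq_zero.1 this).resolve_right h₁.ne
  have hc : c = 0 := by
    have := congrArg (M.form ℝ n₂) hs
    simp only [map_add, map_smul, smul_eq_mul, M.form_comm ℝ n₂ x, M.form_comm ℝ n₂ n₁, hx₂, h₁₂,
      map_zero, mul_zero, zero_add, add_zero] at this
    exact (mul_eq_zero.1 this).resolve_right h₂.ne
  have ha : a ≠ 0 := fun ha => h0 (by simp [ha, hb, hc])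
  rw [hb, hc] at hs
  simp [ha, hx] at hs

theorem map_form (M : IntLattice ι) {R S : Type} [CommRing R] [CommRing S] (f : R →+* S)
    (x y : ι → R) : f (M.form R x y) = M.form S (fun i => f (x i)) (fun i => f (y i)) := by
  simp [form_apply, dotProduct, Matrix.mulVec]

theorem form_ofReal (M : IntLattice ι) (x y : ι → ℝ) :
    M.form ℂ (fun i => (x i : ℂ)) (fun i => (y i : ℂ)) = M.form ℝ x y :=
  (M.map_form Complex.ofRealHom x y).symm

theorem form_ofReal_left (M : IntLattice ι) (x : ι → ℝ) (w : ι → ℂ) :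
    M.form ℂ (fun i => (x i : ℂ)) w =
      M.form ℝ x (fun i => (w i).re) + M.form ℝ x (fun i => (w i).im) * Complex.I := by
  have hw : w = (fun i => (((w i).re : ℝ) : ℂ)) + Complex.I • fun i => (((w i).im : ℝ) : ℂ) := by
    ext i; simp [mul_comm Complex.I]
  conv_lhs => rw [hw]
  rw [map_add, map_smul, form_ofReal, form_ofReal, smul_eq_mul, mul_comm]

theorem form_self_eq (M : IntLattice ι) (w : ι → ℂ) :
    M.form ℂ w w = ((M.form ℝ (fun i => (w i).re) (fun i => (w i).re) -
      M.form ℝ (fun i => (w i).im) (fun i => (w i).im) : ℝ) : ℂ) +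
      ((2 * M.form ℝ (fun i => (w i).re) (fun i => (w i).im) : ℝ) : ℂ) * Complex.I := by
  have hw : w = (fun i => (((w i).re : ℝ) : ℂ)) + Complex.I • fun i => (((w i).im : ℝ) : ℂ) := by
    ext i; simp [mul_comm Complex.I]
  conv_lhs => rw [hw]
  simp only [map_add, map_smul, LinearMap.add_apply, LinearMap.smul_apply, form_ofReal,
    smul_eq_mul, M.form_comm ℝ (fun i => (w i).im) (fun i => (w i).re)]
  push_cast
  linear_combination (M.form ℝ (fun i => (w i).im) (fun i => (w i).im) : ℂ) * Complex.I_sq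

theorem form_star_self_eq (M : IntLattice ι) (w : ι → ℂ) :
    M.form ℂ w (star w) = ((M.form ℝ (fun i => (w i).re) (fun i => (w i).re) +
      M.form ℝ (fun i => (w i).im) (fun i => (w i).im) : ℝ) : ℂ) := by
  have key : ∀ x y : ι → ℝ, M.form ℂ ((fun i => (x i : ℂ)) + Complex.I • fun i => (y i : ℂ))
      ((fun i => (x i : ℂ)) - Complex.I • fun i => (y i : ℂ)) =
        ((M.form ℝ x x + M.form ℝ y y : ℝ) : ℂ) := fun x y => by
    simp only [map_add, map_sub, map_smul, LinearMap.add_apply, LinearMap.smul_apply, form_ofReal,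
      smul_eq_mul, M.form_comm ℝ y x]
    push_cast
    linear_combination -(M.form ℝ y y : ℂ) * Complex.I_sq
  rw [← key]
  congr 2
  · ext i; simp [mul_comm Complex.I]
  · ext i; apply Complex.ext <;> simp

/-- The real and imaginary parts of a period are orthogonal, of the same negative norm. -/
theorem IsPeriod.re_im {M : IntLattice ι} {w : ι → ℂ} (hw : M.IsPeriod w) :
    M.form ℝ (fun i => (w i).re) (fun i => (w i).re) < 0 ∧
    M.form ℝ (fun i => (w i).im) (fun i => (w i).im) < 0 ∧
    M.form ℝ (fun i => (w i).re) (fun i => (w i).im) = 0 := by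
  obtain ⟨h₁, h₂⟩ := hw
  rw [form_self_eq] at h₁
  rw [form_star_self_eq, Complex.ofReal_re] at h₂
  have hr := congrArg Complex.re h₁
  have hi := congrArg Complex.im h₁
  simp at hr hi
  refine ⟨?_, ?_, hi⟩ <;> linarith

/-- A real vector orthogonal to `w` is orthogonal to both its real and imaginary parts, which span a
negative definite plane. -/
theorem PosOnCodimTwo.form_self_pos_of_isPeriod {M : IntLattice ι} (hM : M.PosOnCodimTwo)
    {w : ι → ℂ} (hw : M.IsPeriod w) {x : ι → ℝ} (hx : M.form ℂ (fun i => (x i : ℂ)) w = 0)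
    (hx0 : x ≠ 0) : 0 < M.form ℝ x x := by
  obtain ⟨h₁, h₂, h₁₂⟩ := hw.re_im
  rw [form_ofReal_left] at hx
  have hr := congrArg Complex.re hx
  have hi := congrArg Complex.im hx
  simp at hr hi
  exact hM.form_self_pos h₁ h₂ h₁₂ hr hi hx0

end Signature

/-- Equating the two coordinates in each hyperbolic plane turns its form `2ab` into `2a²`; the `E₈`
summands are already positive. -/
theorem lambdaSharp_posOnCodimTwo : lambdaSharp.PosOnCodimTwo := by
  refine ⟨LinearMap.proj (.inr (0, 0)) - LinearMap.proj (.inr (1, 0)),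
    LinearMap.proj (.inr (0, 1)) - LinearMap.proj (.inr (1, 1)), fun x h₁ h₂ hx => ?_⟩
  simp only [LinearMap.sub_apply, LinearMap.proj_apply, sub_eq_zero] at h₁ h₂
  have h8 : ∀ k ∈ Finset.univ, 0 ≤ e8Form (fun i => x (.inl (i, k))) (fun i => x (.inl (i, k))) :=
    fun k _ => e8Form_self_nonneg _
  have hs := Finset.sum_nonneg h8
  rw [lambdaSharp_form, Fin.sum_univ_two (f := fun k => _ * _ + _), h₁, h₂]
  refine lt_of_le_of_ne (by nlinarith [mul_self_nonneg (x (.inr (1, 0))), mul_self_nonneg (x (.inr (1, 1)))])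
    fun h => hx ?_
  have hu0 : x (.inr (1, 0)) = 0 := by
    nlinarith [mul_self_nonneg (x (.inr (1, 0))), mul_self_nonneg (x (.inr (1, 1)))]
  have hu1 : x (.inr (1, 1)) = 0 := by
    nlinarith [mul_self_nonneg (x (.inr (1, 0))), mul_self_nonneg (x (.inr (1, 1)))]
  have hz : ∀ k, e8Form (fun i => x (.inl (i, k))) (fun i => x (.inl (i, k))) = 0 := fun k =>
    (Finset.sum_eq_zero_iff_of_nonneg h8).1 (by rw [hu0, hu1] at h; linarith) k (Finset.mem_univ _)
  ext (⟨i, k⟩ | ⟨i, k⟩)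
  · exact congrFun (eq_zero_of_e8Form_self_eq_zero (hz k)) i
  · fin_cases i <;> fin_cases k <;> simp [h₁, h₂, hu0, hu1]

theorem lambdaD_posOnCodimTwo {d : ℕ} (hd : 0 < d) : (lambdaD d hd).PosOnCodimTwo := by
  refine ⟨LinearMap.proj (.inl (.inr (0, 0))) - LinearMap.proj (.inl (.inr (1, 0))),
    LinearMap.proj (.inl (.inr (0, 1))) - LinearMap.proj (.inl (.inr (1, 1))), fun x h₁ h₂ hx => ?_⟩
  simp only [LinearMap.sub_apply, LinearMap.proj_apply, sub_eq_zero] at h₁ h₂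
  have hd' : (0 : ℝ) < d := Nat.cast_pos.2 hd
  have h8 : ∀ k ∈ Finset.univ, 0 ≤ e8Form (fun i => x (.inl (.inl (i, k))))
      (fun i => x (.inl (.inl (i, k)))) := fun k _ => e8Form_self_nonneg _
  have hs := Finset.sum_nonneg h8
  have hdx := mul_nonneg hd'.le (mul_self_nonneg (x (.inr 0)))
  rw [lambdaD_form, Fin.sum_univ_two (f := fun k => _ * _ + _), h₁, h₂]
  refine lt_of_le_of_ne (by
    nlinarith [mul_self_nonneg (x (.inl (.inr (1, 0)))), mul_self_nonneg (x (.inl (.inr (1, 1))))])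
    fun h => hx ?_
  have hu0 : x (.inl (.inr (1, 0))) = 0 := by
    nlinarith [mul_self_nonneg (x (.inl (.inr (1, 0)))), mul_self_nonneg (x (.inl (.inr (1, 1))))]
  have hu1 : x (.inl (.inr (1, 1))) = 0 := by
    nlinarith [mul_self_nonneg (x (.inl (.inr (1, 0)))), mul_self_nonneg (x (.inl (.inr (1, 1))))]
  rw [hu0, hu1] at h
  have hx0 : x (.inr 0) = 0 := by
    have : (d : ℝ) * (x (.inr 0) * x (.inr 0)) = 0 := by linarith
    simpa [hd'.ne'] using this
  have hz : ∀ k, e8Form (fun i => x (.inl (.inl (i, k)))) (fun i => x (.inl (.inl (i, k)))) = 0 :=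
    fun k => (Finset.sum_eq_zero_iff_of_nonneg h8).1 (by linarith) k (Finset.mem_univ _)
  ext ((⟨i, k⟩ | ⟨i, k⟩) | i)
  · exact congrFun (eq_zero_of_e8Form_self_eq_zero (hz k)) i
  · fin_cases i <;> fin_cases k <;> simp [h₁, h₂, hu0, hu1]
  · fin_cases i; exact hx0

/-! ### Orthogonal complements of primitive sublattices -/

namespace PrimitiveEmbedding

variable {ι κ : Type} [Fintype ι] [DecidableEq ι] [Fintype κ] [DecidableEq κ]
variable {L : IntLattice ι} {M : IntLattice κ}

/-- A basis of a primitive sublattice extends to a basis of the lattice. -/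
theorem exists_basis_extension (j : PrimitiveEmbedding L M) {τ : Type} [Fintype τ] [DecidableEq τ]
    (hτ : Fintype.card ι + Fintype.card τ = Fintype.card κ) :
    ∃ (C : Matrix κ τ ℤ) (D : Matrix ι κ ℤ) (F : Matrix τ κ ℤ),
      D * j.mat = 1 ∧ D * C = 0 ∧ F * j.mat = 0 ∧ F * C = 1 ∧ j.mat * D + C * F = 1 := by
  set N := LinearMap.range j.toLinearMap with hN
  -- Primitivity makes the quotient torsion-free, hence free, so the projection to it has a section
  -- `s`. The columns of `C` are the lifted quotient basis, and `D`, `F` are the coordinate maps of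
  -- the splitting.
  have htf : Module.IsTorsionFree ℤ ((κ → ℤ) ⧸ N) := by
    rw [Module.isTorsionFree_iff_smul_eq_zero]
    intro n y h
    obtain ⟨y, rfl⟩ := N.mkQ_surjective y
    rw [← map_smul, Submodule.mkQ_apply, Submodule.Quotient.mk_eq_zero] at h
    by_cases hn : n = 0
    · exact .inl hn
    · refine .inr ?_
      rw [Submodule.mkQ_apply, Submodule.Quotient.mk_eq_zero]
      exact j.primitive n y hn h
  have hrank : Module.finrank ℤ ((κ → ℤ) ⧸ N) = Fintype.card τ := by
    have h₁ := N.finrank_quotient_add_finrank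
    rw [LinearMap.finrank_range_of_inj j.injective, Module.finrank_fintype_fun_eq_card,
      Module.finrank_fintype_fun_eq_card] at h₁
    omega
  let b : ((κ → ℤ) ⧸ N) ≃ₗ[ℤ] (τ → ℤ) := LinearEquiv.ofFinrankEq _ _ (by simpa using hrank)
  obtain ⟨s, hs⟩ := Module.projective_lifting_property N.mkQ LinearMap.id N.mkQ_surjective
  have hs' : ∀ q, N.mkQ (s q) = q := fun q => LinearMap.congr_fun hs q
  let e := LinearEquiv.ofInjective j.toLinearMap j.injective
  let p : (κ → ℤ) →ₗ[ℤ] (κ → ℤ) := LinearMap.id - s.comp N.mkQ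
  have hmem : ∀ x, p x ∈ N := fun x => by
    rw [← Submodule.Quotient.mk_eq_zero, ← Submodule.mkQ_apply]
    simp only [p, LinearMap.sub_apply, LinearMap.comp_apply, LinearMap.id_apply, map_sub, hs',
      sub_self]
  let D' : (κ → ℤ) →ₗ[ℤ] (ι → ℤ) := e.symm.toLinearMap.comp (LinearMap.codRestrict N p hmem)
  let F' : (κ → ℤ) →ₗ[ℤ] (τ → ℤ) := b.toLinearMap.comp N.mkQ
  let C' : (τ → ℤ) →ₗ[ℤ] (κ → ℤ) := s.comp b.symm.toLinearMap
  have hJD : ∀ x, j.toLinearMap (D' x) = x - s (N.mkQ x) := fun x => by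
    have h := congrArg Subtype.val (e.apply_symm_apply ⟨_, hmem x⟩)
    exact h
  have hFJ : ∀ x, F' (j.toLinearMap x) = 0 := fun x => by
    have h : N.mkQ (j.toLinearMap x) = 0 := by
      rw [Submodule.mkQ_apply, Submodule.Quotient.mk_eq_zero]
      exact ⟨x, rfl⟩
    simp only [F', LinearMap.comp_apply, h, map_zero]
  have hFC : ∀ x, F' (C' x) = x := fun x => by
    simp [F', C', LinearMap.comp_apply, -Submodule.mkQ_apply, hs']
  have hCF : ∀ x, C' (F' x) = s (N.mkQ x) := fun x => by
    simp [F', C', LinearMap.comp_apply, -Submodule.mkQ_apply]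
  refine ⟨LinearMap.toMatrix' C', LinearMap.toMatrix' D', LinearMap.toMatrix' F', ?_, ?_, ?_, ?_, ?_⟩
  · rw [mat, ← LinearMap.toMatrix'_comp, ← LinearMap.toMatrix'_id]
    congr 1
    refine LinearMap.ext fun x => j.injective ?_
    have h0 : N.mkQ (j.toLinearMap x) = 0 := by
      rw [Submodule.mkQ_apply, Submodule.Quotient.mk_eq_zero]
      exact ⟨x, rfl⟩
    rw [LinearMap.comp_apply, hJD, h0, map_zero, sub_zero, LinearMap.id_apply]
  · rw [← LinearMap.toMatrix'_comp, LinearEquiv.map_eq_zero_iff]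
    refine LinearMap.ext fun x => j.injective ?_
    rw [LinearMap.comp_apply, hJD, ← hCF, hFC, sub_self, LinearMap.zero_apply, map_zero]
  · rw [mat, ← LinearMap.toMatrix'_comp, LinearEquiv.map_eq_zero_iff]
    exact LinearMap.ext hFJ
  · rw [← LinearMap.toMatrix'_comp, ← LinearMap.toMatrix'_id]
    exact congrArg _ (LinearMap.ext hFC)
  · rw [mat, ← LinearMap.toMatrix'_comp, ← LinearMap.toMatrix'_comp, ← map_add,
      ← LinearMap.toMatrix'_id]
    refine congrArg _ (LinearMap.ext fun x => ?_)
    change j.toLinearMap (D' x) + C' (F' x) = x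
    rw [hJD, hCF, sub_add_cancel]

/-- A basis `V` of the orthogonal complement of a primitive sublattice of a unimodular lattice;
the determinant of the complement is that of the sublattice up to sign. -/
theorem exists_orthogonal_basis (j : PrimitiveEmbedding L M) {τ : Type} [Fintype τ] [DecidableEq τ]
    (hτ : Fintype.card ι + Fintype.card τ = Fintype.card κ) (hM : IsUnit M.gram.det) :
    ∃ (V : Matrix κ τ ℤ) (W : Matrix τ κ ℤ) (E : Matrix κ ι ℤ) (D : Matrix ι κ ℤ) (C : Matrix κ τ ℤ),
      Vᵀ * M.gram * j.mat = 0 ∧ W * V = 1 ∧ V * W + E * (j.matᵀ * M.gram) = 1 ∧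
      j.mat * D + C * (Vᵀ * M.gram) = 1 ∧
      ∃ u : ℤ, IsUnit u ∧ L.gram.det = u * (Vᵀ * M.gram * V).det := by
  obtain ⟨C, D, F, hDJ, hDC, hFJ, hFC, h1⟩ := j.exists_basis_extension hτ
  set H := M.gram with hH
  set J := j.mat with hJ
  have hHt : Hᵀ = H := M.isSymm
  have hHH : H * H⁻¹ = 1 := Matrix.mul_nonsing_inv _ hM
  have hHH' : H⁻¹ * H = 1 := Matrix.nonsing_inv_mul _ hM
  have hHit : (H⁻¹)ᵀ = H⁻¹ := by rw [Matrix.transpose_nonsing_inv, hHt]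
  have hVH : (H⁻¹ * Fᵀ)ᵀ * H = F := by
    rw [Matrix.transpose_mul, Matrix.transpose_transpose, hHit, Matrix.mul_assoc, hHH',
      Matrix.mul_one]
  have hHV : H * (H⁻¹ * Fᵀ) = Fᵀ := by rw [← Matrix.mul_assoc, hHH, Matrix.one_mul]
  -- The rows of `F` form a basis of the functionals that vanish on the sublattice. Unimodularity
  -- represents them by lattice vectors, the columns of `H⁻¹ * Fᵀ`, so that `Vᵀ * H = F`.
  refine ⟨H⁻¹ * Fᵀ, Cᵀ * H, H⁻¹ * Dᵀ, D, C, by rw [hVH, hFJ], ?_, ?_, by rw [hVH, h1], ?_⟩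
  · rw [Matrix.mul_assoc, hHV, ← Matrix.transpose_mul, hFC, Matrix.transpose_one]
  · have h2 := congrArg (fun X => H⁻¹ * Xᵀ * H) h1
    simp only [Matrix.transpose_add, Matrix.transpose_mul, Matrix.mul_add, Matrix.add_mul,
      Matrix.transpose_one, Matrix.mul_one, hHH'] at h2
    rw [← h2, add_comm]
    simp only [Matrix.mul_assoc]
  · rw [hVH]
    set S := F * (H⁻¹ * Fᵀ) with hS
    -- The determinant of `Bᵀ * H * X` is found in two ways. Directly, it is block triangular with
    -- diagonal `L.gram, 1`. Through `B * P = 1`, it is the unimodular `Bᵀ * H * B` times a block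
    -- triangular matrix with diagonal `1, S`.
    set B := Matrix.fromCols J C with hB
    set P := Matrix.fromRows D F with hP
    set X := Matrix.fromCols J (H⁻¹ * Fᵀ) with hX
    have hBP : B * P = 1 := by rw [hB, hP, Matrix.fromCols_mul_fromRows, h1]
    have hPB : P * B = 1 := by
      rw [hB, hP, Matrix.fromRows_mul_fromCols, hDJ, hDC, hFJ, hFC, Matrix.fromBlocks_one]
    have hPX : P * X = Matrix.fromBlocks 1 (D * (H⁻¹ * Fᵀ)) 0 S := by
      rw [hX, hP, Matrix.fromRows_mul_fromCols, hDJ, hFJ]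
    have hBX : Bᵀ * H * X = Matrix.fromBlocks L.gram 0 (Cᵀ * H * J) 1 := by
      rw [hX, hB, Matrix.transpose_fromCols, Matrix.fromRows_mul, Matrix.fromRows_mul_fromCols,
        j.mat_isometry, Matrix.mul_assoc Jᵀ, hHV, ← Matrix.transpose_mul, hFJ,
        Matrix.mul_assoc Cᵀ H (H⁻¹ * Fᵀ), hHV, ← Matrix.transpose_mul, hFC, Matrix.transpose_one,
        Matrix.transpose_zero]
    have hdec : Bᵀ * H * X = (Bᵀ * H * B) * (P * X) := by
      rw [Matrix.mul_assoc _ B, ← Matrix.mul_assoc B, hBP, Matrix.one_mul]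
    refine ⟨(Bᵀ * H * B).det, ?_, ?_⟩
    · refine IsUnit.of_mul_eq_one (P * H⁻¹ * Pᵀ).det ?_
      have hBPt : Pᵀ * Bᵀ = 1 := by rw [← Matrix.transpose_mul, hBP, Matrix.transpose_one]
      rw [mul_comm, ← Matrix.det_mul, Matrix.mul_assoc (P * H⁻¹), Matrix.mul_assoc Bᵀ,
        ← Matrix.mul_assoc Pᵀ, hBPt, Matrix.one_mul, Matrix.mul_assoc P, ← Matrix.mul_assoc H⁻¹,
        hHH', Matrix.one_mul, hPB, Matrix.det_one]
    · have h := congrArg Matrix.det hdec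
      rw [hBX, hPX, Matrix.det_mul, Matrix.det_fromBlocks_zero₁₂, Matrix.det_fromBlocks_zero₂₁,
        Matrix.det_one, Matrix.det_one, mul_one, one_mul] at h
      exact h

end PrimitiveEmbedding

/-! ### Existence of primitive embeddings -/

/-- The simple roots with indices 0, 1, 5, 7 and the root `(1, 1, 2, 2, 2, 1, 0, 0)` are pairwise
orthogonal. This vector is their combination with coefficients `c, a, b, 1, e`, and each root has
norm 2. The fixed coefficient 1 makes the vector primitive. -/
theorem e8Form_four_squares (a b c e : ℤ) :
    e8Form (R := ℤ) ![c + e, a + e, 2 * e, 2 * e, 2 * e, b + e, 0, 1]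
      ![c + e, a + e, 2 * e, 2 * e, 2 * e, b + e, 0, 1] =
        2 * (a ^ 2 + b ^ 2 + c ^ 2 + e ^ 2 + 1) := by
  rw [e8Form_eq]
  simp
  ring

/-- Every positive even integer is the norm of a primitive vector of `E₈`. -/
theorem exists_e8Form_eq {d : ℕ} (hd : 0 < d) (he : Even d) :
    ∃ v : Fin 8 → ℤ, v 7 = 1 ∧ e8Form v v = d := by
  obtain ⟨n, rfl⟩ := he
  -- One unit is reserved for the root of coefficient 1. The subtraction is exact because `d > 0`
  -- forces `n ≥ 1`.
  obtain ⟨a, b, c, e, h⟩ := Nat.sum_four_squares (n - 1)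
  refine ⟨_, ?_, (e8Form_four_squares a b c e).trans ?_⟩
  · rfl
  · have : (a ^ 2 + b ^ 2 + c ^ 2 + e ^ 2 + 1 : ℤ) = n := by
      have h' : a ^ 2 + b ^ 2 + c ^ 2 + e ^ 2 + 1 = n := by omega
      exact_mod_cast h'
    rw [this]; push_cast; ring

theorem nonempty_primitiveEmbedding {d : ℕ} (hd : 0 < d) (he : Even d) :
    Nonempty (PrimitiveEmbedding (lambdaD d hd) lambdaSharp) := by
  obtain ⟨v, hv7, hv⟩ := exists_e8Form_eq hd he
  let f : ((((Fin 8 × Fin 2) ⊕ (Fin 2 × Fin 2)) ⊕ Fin 1) → ℤ) →ₗ[ℤ]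
      ((Fin 8 × Fin 3) ⊕ (Fin 2 × Fin 2) → ℤ) :=
    { toFun := fun x => Sum.elim (fun p => ![x (.inl (.inl (p.1, 0))), x (.inl (.inl (p.1, 1))),
        x (.inr 0) * v p.1] p.2) (fun p => x (.inl (.inr p)))
      map_add' := fun x y => by
        ext (⟨i, k⟩ | p)
        · fin_cases k <;> simp [add_mul]
        · simp
      map_smul' := fun n x => by
        ext (⟨i, k⟩ | p)
        · fin_cases k <;> simp [mul_assoc]
        · simp }
  have f0 : ∀ x i, f x (.inl (i, 0)) = x (.inl (.inl (i, 0))) := fun _ _ => rfl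
  have f1 : ∀ x i, f x (.inl (i, 1)) = x (.inl (.inl (i, 1))) := fun _ _ => rfl
  have f2 : ∀ x i, f x (.inl (i, 2)) = x (.inr 0) * v i := fun _ _ => rfl
  have fr : ∀ x p, f x (.inr p) = x (.inl (.inr p)) := fun _ _ => rfl
  refine ⟨⟨f, fun x y h => ?_, fun x y => ?_, fun n y hn hy => ?_⟩⟩
  · ext ((⟨i, k⟩ | p) | i)
    · have h0 := congrFun h (.inl (i, 0))
      have h1 := congrFun h (.inl (i, 1))
      rw [f0, f0] at h0
      rw [f1, f1] at h1
      fin_cases k <;> assumption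
    · exact congrFun h (.inr p)
    · have h2 := congrFun h (.inl (7, 2))
      rw [f2, f2, hv7, mul_one, mul_one] at h2
      fin_cases i
      exact h2
  · rw [lambdaSharp_form, lambdaD_form]
    simp only [Fin.sum_univ_three, f0, f1, f2, fr, Fin.sum_univ_two (M := ℤ)]
    have : e8Form (fun i => x (.inr 0) * v i) (fun i => y (.inr 0) * v i) =
        d * (x (.inr 0) * y (.inr 0)) := by
      have h := congrArg (fun t => t * (x (.inr 0) * y (.inr 0))) hv
      rw [e8Form_eq] at h ⊢
      linear_combination h
    rw [this]
    ring
  · obtain ⟨x, hx⟩ := hy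
    have hx' : ∀ q, f x q = n * y q := fun q => congrFun hx q
    -- As `v 7 = 1`, this coordinate shows that the multiplier `x (.inr 0)` of `v` is itself
    -- divisible by `n`.
    have h7 := hx' (.inl (7, 2))
    rw [f2, hv7, mul_one] at h7
    refine ⟨Sum.elim (Sum.elim (fun p => y (.inl (p.1, p.2.castSucc))) fun p => y (.inr p))
      fun _ => y (.inl (7, 2)), ?_⟩
    ext (⟨i, k⟩ | p)
    · fin_cases k
      · rfl
      · rfl
      · have h2 := hx' (.inl (i, 2))
        rw [f2, h7, mul_assoc] at h2
        exact mul_left_cancel₀ hn h2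
    · rfl

/-! ### Determinants of the two lattices -/

theorem gramEU_det_eq (a b : ℕ) : (gramEU a b).det = (-1) ^ b := by
  have hU : gramU.det = -1 := by simp [gramU, Matrix.det_fin_two]
  rw [gramEU, Matrix.det_fromBlocks_zero₂₁, Matrix.det_blockDiagonal, Matrix.det_blockDiagonal]
  simp [hU, CartanMatrix.E₈_det]

theorem lambdaSharp_det : lambdaSharp.gram.det = 1 := by
  rw [lambdaSharp, gramEU_det_eq]; norm_num

theorem lambdaD_det {d : ℕ} (hd : 0 < d) : (lambdaD d hd).gram.det = d := by
  rw [lambdaD, Matrix.det_fromBlocks_zero₂₁, gramEU_det_eq]; simp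

end IntLattice

/-! ### Irreducibility of domains -/

section Analytic

variable {E : Type*} [NormedAddCommGroup E] [NormedSpace ℂ E]

/-- Near every point of `D`, the set `A` is cut out in `D` by finitely many holomorphic functions. -/
def LocallyZeroLocus (D A : Set E) : Prop :=
  ∀ z ∈ D, ∃ U : Set E, IsOpen U ∧ z ∈ U ∧ ∃ (k : ℕ) (f : Fin k → E → ℂ),
    (∀ i, AnalyticOnNhd ℂ (f i) U) ∧ ∀ y ∈ D, y ∈ U → (y ∈ A ↔ ∀ i, f i y = 0)

/-- The interior of `A` is relatively closed in `D`: a small ball around `z` contains an interior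
point, near which the local equations vanish, so they vanish on the whole ball by the identity
theorem. -/
theorem LocallyZeroLocus.eventually_mem {D A : Set E} (hD : IsOpen D) (hA : LocallyZeroLocus D A)
    {z : E} (hz : z ∈ D) (h : z ∈ closure {y | ∀ᶠ x in nhds y, x ∈ A}) :
    ∀ᶠ x in nhds z, x ∈ A := by
  obtain ⟨U, hU, hzU, k, f, hf, hfA⟩ := hA z hz
  obtain ⟨r, hr, hb⟩ := Metric.isOpen_iff.1 (hU.inter hD) z ⟨hzU, hz⟩
  have hconn : IsPreconnected (Metric.ball z r) := (convex_ball z r : Convex ℝ _).isPreconnected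
  obtain ⟨y, hy, hyA⟩ := mem_closure_iff.1 h _ Metric.isOpen_ball (Metric.mem_ball_self hr)
  have hzero : ∀ i, Set.EqOn (f i) 0 (Metric.ball z r) := fun i => by
    refine ((hf i).mono fun x hx => (hb hx).1).eqOn_zero_of_preconnected_of_eventuallyEq_zero
      hconn hy ?_
    filter_upwards [hyA, Metric.isOpen_ball.mem_nhds hy] with x hxA hx
    exact (hfA x (hb hx).2 (hb hx).1).1 hxA i
  filter_upwards [Metric.ball_mem_nhds z hr] with x hx
  exact (hfA x (hb hx).2 (hb hx).1).2 fun i => hzero i hx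

/-- An analytic subset of a connected domain with an interior point is the whole domain. -/
theorem LocallyZeroLocus.subset {D A : Set E} (hD : IsOpen D) (hc : IsPreconnected D)
    (hA : LocallyZeroLocus D A) {z : E} (hz : z ∈ D) (h : ∀ᶠ x in nhds z, x ∈ A) : D ⊆ A := by
  have hs : D ⊆ {y | ∀ᶠ x in nhds y, x ∈ A} :=
    hc.subset_of_closure_inter_subset (isOpen_setOfPred_eventually_nhds) ⟨z, hz, h⟩
      fun y hy => hA.eventually_mem hD hy.2 hy.1
  exact fun y hy => (hs hy).self_of_nhds

/-- Off `A` some local equation is nonzero, hence nonzero nearby. This closedness is what Baire's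
theorem needs. -/
theorem LocallyZeroLocus.isClosed_preimage {D A : Set E} (hA : LocallyZeroLocus D A) :
    IsClosed ((↑) ⁻¹' A : Set D) := by
  rw [← isOpen_compl_iff, isOpen_iff_mem_nhds]
  rintro ⟨z, hz⟩ hzA
  obtain ⟨U, hU, hzU, k, f, hf, hfA⟩ := hA z hz
  have h : ∃ i, f i z ≠ 0 := by
    by_contra! h
    exact hzA ((hfA z hz hzU).2 h)
  obtain ⟨i, hi⟩ := h
  have h1 : ∀ᶠ y in nhds z, f i y ≠ 0 := (hf i z hzU).continuousAt.eventually_ne hi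
  have h2 : ∀ᶠ y in nhds z, f i y ≠ 0 ∧ y ∈ U := h1.and (hU.mem_nhds hzU)
  filter_upwards [continuous_subtype_val.continuousAt.eventually h2] with y hy hyA
  exact hy.1 ((hfA y y.2 hy.2).1 hyA i)

/-- A connected domain is not a countable union of proper analytic subsets. -/
theorem LocallyZeroLocus.exists_subset_of_subset_iUnion [CompleteSpace E] {D : Set E}
    (hD : IsOpen D) (hc : IsPreconnected D) (hne : D.Nonempty) {α : Type*} [Countable α]
    {A : α → Set E} (hA : ∀ a, LocallyZeroLocus D (A a)) (h : D ⊆ ⋃ a, A a) : ∃ a, D ⊆ A a := by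
  have := hD.baireSpace
  have := hne.to_subtype
  obtain ⟨a, ⟨z, hz⟩, hza⟩ := nonempty_interior_of_iUnion_of_closed
    (fun a => (hA a).isClosed_preimage) (by
      rw [← Set.preimage_iUnion, Set.eq_univ_iff_forall]; exact fun x => h x.2)
  refine ⟨a, (hA a).subset hD hc hz ?_⟩
  rw [mem_interior_iff_mem_nhds, mem_nhds_subtype_iff_nhdsWithin, hD.nhdsWithin_eq hz] at hza
  filter_upwards [hza] with x hx
  obtain ⟨y, hy, rfl⟩ := hx
  exact hy

theorem LocallyZeroLocus.subset_or_subset [CompleteSpace E] {D A B : Set E}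
    (hD : IsOpen D) (hc : IsPreconnected D) (hne : D.Nonempty)
    (hA : LocallyZeroLocus D A) (hB : LocallyZeroLocus D B) (h : D ⊆ A ∪ B) : D ⊆ A ∨ D ⊆ B := by
  obtain ⟨a, ha⟩ := LocallyZeroLocus.exists_subset_of_subset_iUnion hD hc hne
    (A := fun b : Bool => cond b A B) (by rintro (_ | _) <;> assumption)
    (by rwa [← Set.union_eq_iUnion])
  cases a
  · exact .inr ha
  · exact .inl ha

end Analytic

namespace IntLattice

/-! ### Points of period domains -/

section Points

variable {ι κ : Type} [Fintype ι] [DecidableEq ι] [Fintype κ] [DecidableEq κ]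

theorem Omega.mk_smul {M : IntLattice ι} {w : ι → ℂ} (hw : M.IsPeriod w) {c : ℂ} (hc : c ≠ 0) :
    Omega.mk (c • w) (hw.smul hc) = Omega.mk w hw :=
  Subtype.ext ((Projectivization.mk_eq_mk_iff ..).2 ⟨Units.mk0 c hc, rfl⟩)

theorem Omega.mk_rep {M : IntLattice ι} (p : M.Omega) : Omega.mk p.1.rep p.2 = p :=
  Subtype.ext (Projectivization.mk_rep p.1)

theorem PrimitiveEmbedding.omegaMap_mk {L : IntLattice ι} {M : IntLattice κ}
    (j : PrimitiveEmbedding L M) {w : ι → ℂ} (hw : L.IsPeriod w) :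
    j.omegaMap (Omega.mk w hw) = Omega.mk (j.complexify w) (j.isPeriod_complexify hw) := by
  obtain ⟨a, ha⟩ := Projectivization.exists_smul_eq_mk_rep ℂ w hw.ne_zero
  have h : j.complexify (Omega.mk w hw).1.rep = (a : ℂ) • j.complexify w := by
    rw [← map_smul]; exact congrArg _ ha.symm
  refine Subtype.ext ((Projectivization.mk_eq_mk_iff ..).2 ⟨a, h.symm⟩)

theorem toPeriodSpace_mk_eq {M : IntLattice ι} {g : GL ι ℤ} (hg : g ∈ M.monodromyGroup)
    {w w' : ι → ℂ} (hw : M.IsPeriod w) (hw' : M.IsPeriod w') (h : act ℂ g • w = w') :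
    M.toPeriodSpace (Omega.mk w hw) = M.toPeriodSpace (Omega.mk w' hw') := by
  refine Quotient.sound ⟨g, hg, ?_⟩
  subst h
  exact Projectivization.smul_mk ..

/-- Analytic subsets pull back to analytic subsets along holomorphic maps. -/
theorem IsAnalyticInOmega.locallyZeroLocus {E : Type*} [NormedAddCommGroup E] [NormedSpace ℂ E]
    {M : IntLattice ι} {A : Set M.Omega} (hA : M.IsAnalyticInOmega A) {D : Set E} {g : E → ι → ℂ}
    (hg : ∀ z, AnalyticAt ℂ g z) (hD : ∀ z ∈ D, M.IsPeriod (g z)) :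
    LocallyZeroLocus D {z | ∃ h : M.IsPeriod (g z), Omega.mk (g z) h ∈ A} := by
  intro z hz
  obtain ⟨U, hU, hzU, k, f, hf, hfA⟩ := hA (g z) (hD z hz)
  have hgc : Continuous g := continuous_iff_continuousAt.2 fun y => (hg y).continuousAt
  refine ⟨g ⁻¹' U, hU.preimage hgc, hzU, k, fun i => f i ∘ g,
    fun i y hy => (hf i (g y) hy).comp (hg y), fun y hy hyU => ?_⟩
  exact Iff.trans ⟨fun h => h.2, fun h => ⟨hD y hy, h⟩⟩ (hfA (g y) (hD y hy) hyU)

end Points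

/-! ### The tube domain model of `Ω(Λ_d)` -/

/-- The index set of the coordinates of `Λ_d`. -/
abbrev DIndex : Type := ((Fin 8 × Fin 2) ⊕ (Fin 2 × Fin 2)) ⊕ Fin 1

/-- The pairing of the components in `E₈^{⊕ 2} ⊕ U ⊕ ⟨d⟩`, the orthogonal complement of the first
hyperbolic plane of `Λ_d`. -/
def hypPart (d : ℕ) {R : Type} [CommRing R] (x y : DIndex → R) : R :=
  (∑ k, e8Form (fun i => x (.inl (.inl (i, k)))) (fun i => y (.inl (.inl (i, k))))) +
    (x (.inl (.inr (0, 1))) * y (.inl (.inr (1, 1))) +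
      x (.inl (.inr (1, 1))) * y (.inl (.inr (0, 1)))) + d * (x (.inr 0) * y (.inr 0))

theorem lambdaD_form_eq {R : Type} [CommRing R] {d : ℕ} (hd : 0 < d) (x y : DIndex → R) :
    (lambdaD d hd).form R x y = x (.inl (.inr (0, 0))) * y (.inl (.inr (1, 0))) +
      x (.inl (.inr (1, 0))) * y (.inl (.inr (0, 0))) + hypPart d x y := by
  rw [lambdaD_form, Fin.sum_univ_two (f := fun k => _ * _ + _), hypPart]
  ring

/-- The vector `e - ⟨z, z⟩ / 2 f + z`, with `z` in the complement of the first hyperbolic plane. -/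
def tubePoint (d : ℕ) (z : DIndex → ℂ) : DIndex → ℂ := fun i =>
  if i = .inl (.inr (0, 0)) then 1 else if i = .inl (.inr (1, 0)) then -hypPart d z z / 2 else z i

@[simp] theorem tubePoint_e (d : ℕ) (z : DIndex → ℂ) : tubePoint d z (.inl (.inr (0, 0))) = 1 := by
  simp [tubePoint]

@[simp] theorem tubePoint_f (d : ℕ) (z : DIndex → ℂ) :
    tubePoint d z (.inl (.inr (1, 0))) = -hypPart d z z / 2 := by
  simp [tubePoint]

@[simp] theorem tubePoint_inl_inl (d : ℕ) (z : DIndex → ℂ) (p : Fin 8 × Fin 2) :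
    tubePoint d z (.inl (.inl p)) = z (.inl (.inl p)) := by
  simp [tubePoint]

@[simp] theorem tubePoint_inl_inr (d : ℕ) (z : DIndex → ℂ) (i : Fin 2) :
    tubePoint d z (.inl (.inr (i, 1))) = z (.inl (.inr (i, 1))) := by
  simp [tubePoint]

@[simp] theorem tubePoint_inr (d : ℕ) (z : DIndex → ℂ) (i : Fin 1) :
    tubePoint d z (.inr i) = z (.inr i) := by
  simp [tubePoint]

/-- The projection to the orthogonal complement of the first hyperbolic plane. -/
def hypProj {R : Type} [CommRing R] (z : DIndex → R) : DIndex → R := fun i =>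
  if i = .inl (.inr (0, 0)) then 0 else if i = .inl (.inr (1, 0)) then 0 else z i

theorem lambdaD_form_hypProj {R : Type} [CommRing R] {d : ℕ} (hd : 0 < d) (x y : DIndex → R) :
    (lambdaD d hd).form R (hypProj x) (hypProj y) = hypPart d x y := by
  rw [lambdaD_form_eq]; simp [hypProj, hypPart]

/-- `hypPart` is the lattice form of the projected vectors, and the projection commutes with real
and imaginary parts, so the general identity `form_self_eq` applies. -/
theorem hypPart_self_eq {d : ℕ} (hd : 0 < d) (z : DIndex → ℂ) :
    hypPart d z z = ((hypPart d (fun i => (z i).re) (fun i => (z i).re) -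
      hypPart d (fun i => (z i).im) (fun i => (z i).im) : ℝ) : ℂ) +
      ((2 * hypPart d (fun i => (z i).re) (fun i => (z i).im) : ℝ) : ℂ) * Complex.I := by
  have hr : (fun i => (hypProj z i).re) = hypProj fun i => (z i).re := by
    ext i; simp only [hypProj]; split_ifs <;> simp
  have hi : (fun i => (hypProj z i).im) = hypProj fun i => (z i).im := by
    ext i; simp only [hypProj]; split_ifs <;> simp
  rw [← lambdaD_form_hypProj hd, form_self_eq, hr, hi]
  simp only [lambdaD_form_hypProj]

theorem hypPart_star_self_eq {d : ℕ} (hd : 0 < d) (z : DIndex → ℂ) :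
    hypPart d z (star z) = ((hypPart d (fun i => (z i).re) (fun i => (z i).re) +
      hypPart d (fun i => (z i).im) (fun i => (z i).im) : ℝ) : ℂ) := by
  have hr : (fun i => (hypProj z i).re) = hypProj fun i => (z i).re := by
    ext i; simp only [hypProj]; split_ifs <;> simp
  have hi : (fun i => (hypProj z i).im) = hypProj fun i => (z i).im := by
    ext i; simp only [hypProj]; split_ifs <;> simp
  have hs : hypProj (star z) = star (hypProj z) := by
    ext i; simp only [hypProj, Pi.star_apply]; split_ifs <;> simp
  rw [← lambdaD_form_hypProj hd, hs, form_star_self_eq, hr, hi]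
  simp only [lambdaD_form_hypProj]

/-- Isotropy is built into the `f`-coordinate. In `⟨w, w̄⟩` the first hyperbolic plane contributes
`-Re ⟨z, z⟩`, which cancels the real part of `z` and doubles the imaginary part. -/
theorem isPeriod_tubePoint_iff {d : ℕ} (hd : 0 < d) (z : DIndex → ℂ) :
    (lambdaD d hd).IsPeriod (tubePoint d z) ↔
      hypPart d (fun i => (z i).im) (fun i => (z i).im) < 0 := by
  have h₁ : hypPart d (tubePoint d z) (tubePoint d z) = hypPart d z z := by simp [hypPart]
  have h₂ : hypPart d (tubePoint d z) (star (tubePoint d z)) = hypPart d z (star z) := by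
    simp [hypPart]
  rw [IsPeriod, lambdaD_form_eq, lambdaD_form_eq, h₁, h₂, Pi.star_apply, Pi.star_apply]
  simp only [tubePoint_e, tubePoint_f]
  have h₃ : (1 * star (-hypPart d z z / 2) + -hypPart d z z / 2 * star 1 +
      hypPart d z (star z)).re = 2 * hypPart d (fun i => (z i).im) (fun i => (z i).im) := by
    rw [hypPart_star_self_eq hd, hypPart_self_eq hd]
    simp
    ring
  rw [h₃]
  constructor
  · rintro ⟨-, h⟩; linarith
  · intro h; exact ⟨by ring, by linarith⟩

/-- The tube domain: a connected component of the set of `z` such that `tubePoint d z` is a period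
(the coordinates in the first hyperbolic plane are redundant). -/
def tubeDomain (d : ℕ) : Set (DIndex → ℂ) :=
  {z | 0 < (z (.inl (.inr (0, 1)))).im ∧ (z (.inl (.inr (1, 1)))).im < 0 ∧
    hypPart d (fun i => (z i).im) (fun i => (z i).im) < 0}

theorem isOpen_tubeDomain (d : ℕ) : IsOpen (tubeDomain d) := by
  have h : Continuous fun z : DIndex → ℂ => hypPart d (fun i => (z i).im) (fun i => (z i).im) := by
    simp only [hypPart, e8Form_eq]
    fun_prop
  have hi : ∀ i : DIndex, Continuous fun z : DIndex → ℂ => (z i).im := fun i => by fun_prop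
  exact (isOpen_lt continuous_const (hi _)).inter
    ((isOpen_lt (hi _) continuous_const).inter (isOpen_lt h continuous_const))

/-- The base point of the tube domain. -/
def tubeBase : DIndex → ℂ :=
  Pi.single (.inl (.inr (0, 1))) Complex.I - Pi.single (.inl (.inr (1, 1))) Complex.I

theorem tubeBase_mem (d : ℕ) : tubeBase ∈ tubeDomain d := by
  simp [tubeDomain, tubeBase, hypPart, e8Form_eq]

theorem e8Form_mul (t : ℝ) (x : Fin 8 → ℝ) :
    e8Form (fun i => t * x i) (fun i => t * x i) = t ^ 2 * e8Form x x := by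
  rw [e8Form_eq, e8Form_eq]; ring

/-- The imaginary part of the base point has norm `-2` and pairs negatively with that of every point
of the domain. So all terms of the expanded norm are nonpositive, and one is strictly negative
because `s + t = 1`. -/
theorem starConvex_tubeDomain (d : ℕ) : StarConvex ℝ tubeBase (tubeDomain d) := by
  rintro z ⟨ha, hb, hz⟩ s t hs ht hst
  have hst' : 0 < s ∨ 0 < t := by
    rcases hs.lt_or_eq with h | h
    · exact .inl h
    · exact .inr (by linarith)
  have e : ∀ i, ((s • tubeBase + t • z) i).im = s * (tubeBase i).im + t * (z i).im := fun i => by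
    simp
  have ea : ((s • tubeBase + t • z) (.inl (.inr (0, 1)))).im =
      s + t * (z (.inl (.inr (0, 1)))).im := by
    rw [e]; simp [tubeBase]
  have eb : ((s • tubeBase + t • z) (.inl (.inr (1, 1)))).im =
      -s + t * (z (.inl (.inr (1, 1)))).im := by
    rw [e]; simp [tubeBase]
  have e0 : ((s • tubeBase + t • z) (.inr 0)).im = t * (z (.inr 0)).im := by
    rw [e]; simp [tubeBase]
  have e8 : ∀ k, (fun i => ((s • tubeBase + t • z) (.inl (.inl (i, k)))).im) =
      fun i => t * (z (.inl (.inl (i, k)))).im := fun k => by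
    ext i; rw [e]; simp [tubeBase]
  refine ⟨?_, ?_, ?_⟩
  · rw [ea]
    rcases hst' with h | h
    · linarith [mul_nonneg ht ha.le]
    · linarith [mul_pos h ha]
  · rw [eb]
    rcases hst' with h | h
    · linarith [mul_nonneg ht (neg_pos.2 hb).le]
    · linarith [mul_pos h (neg_pos.2 hb)]
  · have key : hypPart d (fun i => ((s • tubeBase + t • z) i).im)
        (fun i => ((s • tubeBase + t • z) i).im) =
        t ^ 2 * hypPart d (fun i => (z i).im) (fun i => (z i).im) - 2 * s ^ 2 -
          2 * (s * t * ((z (.inl (.inr (0, 1)))).im - (z (.inl (.inr (1, 1)))).im)) := by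
      simp only [hypPart, e8, ea, eb, e0, e8Form_mul, ← Finset.mul_sum]
      ring
    rw [key]
    have h₁ : 0 ≤ s * t * ((z (.inl (.inr (0, 1)))).im - (z (.inl (.inr (1, 1)))).im) :=
      mul_nonneg (mul_nonneg hs ht) (by linarith)
    rcases hst' with h | h
    · nlinarith [sq_nonneg t, pow_pos h 2]
    · nlinarith [pow_pos h 2, sq_nonneg s]

theorem isPreconnected_tubeDomain (d : ℕ) : IsPreconnected (tubeDomain d) :=
  ((starConvex_tubeDomain d).isPathConnected (tubeBase_mem d)).isConnected.isPreconnected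

theorem analyticAt_tubePoint (d : ℕ) (z : DIndex → ℂ) : AnalyticAt ℂ (tubePoint d) z := by
  have hp : ∀ i : DIndex, AnalyticAt ℂ (fun z : DIndex → ℂ => z i) z := fun i =>
    (ContinuousLinearMap.proj (R := ℂ) (φ := fun _ : DIndex => ℂ) i).analyticAt z
  have hh : AnalyticAt ℂ (fun z : DIndex → ℂ => hypPart d z z) z := by
    have hm : ∀ i j : DIndex, AnalyticAt ℂ (fun z : DIndex → ℂ => z i * z j) z :=
      fun i j => (hp i).mul (hp j)
    simp only [hypPart, e8Form, dotProduct, Matrix.mulVec, Finset.mul_sum]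
    refine ((Finset.analyticAt_fun_sum _ fun k _ => Finset.analyticAt_fun_sum _ fun i _ =>
      Finset.analyticAt_fun_sum _ fun l _ => (hp _).mul (analyticAt_const.mul (hp _))).add
        ((hm _ _).add (hm _ _))).add (analyticAt_const.mul (hm _ _))
  refine analyticAt_pi_iff.2 fun i => ?_
  simp only [tubePoint]
  split_ifs
  · exact analyticAt_const
  · exact hh.neg.div_const
  · exact hp i

/-- The exchange of the two generators of the second hyperbolic plane. -/
def swapU : GL DIndex ℤ :=
  Matrix.GeneralLinearGroup.mk''
    ((Equiv.swap (Sum.inl (Sum.inr (0, 1)) : DIndex) (.inl (.inr (1, 1)))).permMatrix ℤ) (by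
      rw [Matrix.det_permutation, Equiv.Perm.sign_swap (by simp)]; simp)

theorem act_swapU_smul (R : Type) [CommRing R] (x : DIndex → R) :
    act R swapU • x = x ∘ Equiv.swap (Sum.inl (Sum.inr (0, 1)) : DIndex) (.inl (.inr (1, 1))) := by
  have h : ((swapU : Matrix DIndex DIndex ℤ)).map (Int.castRingHom R) =
      (Equiv.swap (Sum.inl (Sum.inr (0, 1)) : DIndex) (.inl (.inr (1, 1)))).permMatrix R :=
    PEquiv.map_toMatrix ..
  rw [act_smul, h, Matrix.permMatrix_mulVec]

theorem hypPart_swap {R : Type} [CommRing R] (d : ℕ) (x y : DIndex → R) :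
    hypPart d (x ∘ Equiv.swap (Sum.inl (Sum.inr (0, 1)) : DIndex) (.inl (.inr (1, 1))))
      (y ∘ Equiv.swap (Sum.inl (Sum.inr (0, 1)) : DIndex) (.inl (.inr (1, 1)))) = hypPart d x y := by
  have h : ∀ i : DIndex, i ≠ .inl (.inr (0, 1)) → i ≠ .inl (.inr (1, 1)) →
      Equiv.swap (Sum.inl (Sum.inr (0, 1)) : DIndex) (.inl (.inr (1, 1))) i = i :=
    fun i h₁ h₂ => Equiv.swap_apply_of_ne_of_ne h₁ h₂
  simp only [hypPart, Function.comp_apply, Equiv.swap_apply_left, Equiv.swap_apply_right]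
  simp only [h (.inr 0) (by simp) (by simp), h (.inl (.inl _)) (by simp) (by simp)]
  ring

theorem swapU_mem {d : ℕ} (hd : 0 < d) : swapU ∈ (lambdaD d hd).monodromyGroup := by
  refine ⟨fun x y => ?_, fun v hv => ?_⟩
  · rw [act_swapU_smul, act_swapU_smul, lambdaD_form_eq, lambdaD_form_eq, hypPart_swap]
    have h : ∀ i : Fin 2, Equiv.swap (Sum.inl (Sum.inr (0, 1)) : DIndex) (.inl (.inr (1, 1)))
        (.inl (.inr (i, 0))) = .inl (.inr (i, 0)) :=
      fun i => Equiv.swap_apply_of_ne_of_ne (by simp) (by simp)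
    simp only [Function.comp_apply, h]
  · have hs : ∀ i : DIndex, (fun k => ((Pi.single i 1 : DIndex → ℤ) k : ℚ)) ∈
        (lambdaD d hd).integral := fun i => ⟨Pi.single i 1, rfl⟩
    -- Pairing with one generator of `U` reads off the coordinate at the other, so both coordinates
    -- of a dual vector are integers and exchanging them changes it by a lattice vector.
    obtain ⟨m, hm⟩ := Submodule.mem_one.1 (hv _ (hs (.inl (.inr (0, 1)))))
    obtain ⟨n, hn⟩ := Submodule.mem_one.1 (hv _ (hs (.inl (.inr (1, 1)))))
    rw [lambdaD_form_eq] at hm hn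
    simp [hypPart, e8Form_eq] at hm hn
    refine ⟨(Pi.single (.inl (.inr (0, 1))) (m - n) + Pi.single (.inl (.inr (1, 1))) (n - m) :
      DIndex → ℤ), ?_⟩
    rw [act_swapU_smul]
    ext i
    change (((Pi.single (.inl (.inr (0, 1))) (m - n) + Pi.single (.inl (.inr (1, 1))) (n - m) :
      DIndex → ℤ) i : ℤ) : ℚ) = v (Equiv.swap _ _ i) - v i
    rcases eq_or_ne i (.inl (.inr (0, 1))) with rfl | h₁
    · rw [Equiv.swap_apply_left]; simp [hm, hn]
    rcases eq_or_ne i (.inl (.inr (1, 1))) with rfl | h₂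
    · rw [Equiv.swap_apply_right]; simp [hm, hn]
    · rw [Equiv.swap_apply_of_ne_of_ne h₁ h₂]; simp [h₁, h₂]

theorem exists_tubePoint_of_isPeriod {d : ℕ} (hd : 0 < d) {w : DIndex → ℂ}
    (hw : (lambdaD d hd).IsPeriod w) : ∃ c : ℂ, c ≠ 0 ∧ ∃ z, w = c • tubePoint d z := by
  have he : w (.inl (.inr (0, 0))) ≠ 0 := fun h0 => by
    -- If the `e`-coordinate vanished, the isotropic vector `f` would be orthogonal to a period,
    -- contrary to positivity.
    let x : DIndex → ℝ := Pi.single (.inl (.inr (1, 0))) 1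
    have hx : x ≠ 0 := fun h => by simpa [x] using congrFun h (.inl (.inr (1, 0)))
    have h₁ : (lambdaD d hd).form ℂ (fun i => (x i : ℂ)) w = 0 := by
      rw [lambdaD_form_eq]
      simp [x, hypPart, e8Form_eq, h0]
    have h₂ := (lambdaD_posOnCodimTwo hd).form_self_pos_of_isPeriod hw h₁ hx
    rw [lambdaD_form_eq] at h₂
    simp [x, hypPart, e8Form_eq] at h₂
  refine ⟨_, he, (w (.inl (.inr (0, 0))))⁻¹ • w, ?_⟩
  refine ((inv_smul_eq_iff₀ he).1 ?_)
  set z := (w (.inl (.inr (0, 0))))⁻¹ • w with hz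
  have hze : z (.inl (.inr (0, 0))) = 1 := inv_mul_cancel₀ he
  have h0 := (hw.smul (inv_ne_zero he)).1
  rw [← hz, lambdaD_form_eq, hze] at h0
  ext i
  simp only [tubePoint]
  split_ifs with h₁ h₂
  · rw [h₁, hze]
  · rw [h₂]; linear_combination h0 / 2
  · rfl

/-- The points of the tube domain span `Λ_d ⊗ ℂ`. -/
theorem eq_zero_of_dotProduct_tubePoint {d : ℕ} {u : DIndex → ℂ}
    (h : ∀ z ∈ tubeDomain d, u ⬝ᵥ tubePoint d z = 0) : u = 0 := by
  have key : ∀ z ∈ tubeDomain d, z (.inl (.inr (0, 0))) = 0 → z (.inl (.inr (1, 0))) = 0 →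
      u ⬝ᵥ z + u (.inl (.inr (0, 0))) - u (.inl (.inr (1, 0))) * (hypPart d z z / 2) = 0 := by
    intro z hz he hf
    have e : tubePoint d z = z + Pi.single (.inl (.inr (0, 0))) 1 -
        Pi.single (.inl (.inr (1, 0))) (hypPart d z z / 2) := by
      ext i
      simp only [tubePoint, Pi.add_apply, Pi.sub_apply]
      split_ifs with h₁ h₂
      · subst h₁; simp [he]
      · subst h₂; simp [hf, neg_div]
      · simp [h₁, h₂]
    rw [← h z hz, e, dotProduct_sub, dotProduct_add, dotProduct_single, dotProduct_single, mul_one]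
  -- Along the ray through the base point the condition is a quadratic polynomial in `t`; its values
  -- at 1, 2, 3 determine its coefficients, which therefore vanish.
  have hscale : ∀ t : ℝ, 0 < t → u (.inl (.inr (0, 0))) - t ^ 2 * u (.inl (.inr (1, 0))) +
      t * (u ⬝ᵥ tubeBase) = 0 := by
    intro t ht
    have hm : t • tubeBase ∈ tubeDomain d := by
      simp [tubeDomain, tubeBase, hypPart, e8Form_eq, ht]
    have h1 := key _ hm (by simp [tubeBase]) (by simp [tubeBase])
    have h2 : hypPart d (t • tubeBase) (t • tubeBase) = 2 * t ^ 2 := by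
      simp [tubeBase, hypPart, e8Form_eq]
      linear_combination (-2 * t ^ 2 : ℂ) * Complex.I_sq
    rw [h2, dotProduct_smul, Complex.real_smul] at h1
    linear_combination h1
  have h1 := hscale 1 one_pos
  have h2 := hscale 2 two_pos
  have h3 := hscale 3 three_pos
  push_cast at h1 h2 h3
  have hf : u (.inl (.inr (1, 0))) = 0 := by linear_combination -(h1 - 2 * h2 + h3) / 2
  have he : u (.inl (.inr (0, 0))) = 0 := by linear_combination 3 * h1 - 3 * h2 + h3
  have hb : u ⬝ᵥ tubeBase = 0 := by linear_combination h1 - he + hf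
  ext i
  rcases eq_or_ne i (.inl (.inr (0, 0))) with rfl | h₁
  · exact he
  rcases eq_or_ne i (.inl (.inr (1, 0))) with rfl | h₂
  · exact hf
  -- Real translations preserve the tube domain; translating the base point by a unit vector
  -- isolates the coordinate `u i`.
  · have him : ∀ k, ((tubeBase + Pi.single i 1 : DIndex → ℂ) k).im = (tubeBase k).im := fun k => by
      rcases eq_or_ne k i with rfl | hk
      · simp
      · simp [hk]
    have hm : tubeBase + Pi.single i 1 ∈ tubeDomain d := by
      have := tubeBase_mem d
      simp only [tubeDomain, Set.mem_ofPred_eq, him] at this ⊢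
      exact this
    have h4 := key _ hm (by simp [tubeBase, h₁.symm]) (by simp [tubeBase, h₂.symm])
    rw [hf, he, dotProduct_add, hb, dotProduct_single] at h4
    simpa using h4

/-- Every point of the period space of `Λ_d` comes from the tube domain. -/
theorem exists_mem_tubeDomain {d : ℕ} (hd : 0 < d) (x : (lambdaD d hd).PeriodSpace) :
    ∃ z ∈ tubeDomain d, ∃ h : (lambdaD d hd).IsPeriod (tubePoint d z),
      x = (lambdaD d hd).toPeriodSpace (Omega.mk (tubePoint d z) h) := by
  obtain ⟨p, rfl⟩ := Quotient.exists_rep x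
  obtain ⟨c, hc, z, hz⟩ := exists_tubePoint_of_isPeriod hd p.2
  have hp : (lambdaD d hd).IsPeriod (tubePoint d z) := by
    have h := p.2.smul (inv_ne_zero hc)
    rwa [hz, inv_smul_smul₀ hc] at h
  have hpe : p = Omega.mk (tubePoint d z) hp := by
    rw [← Omega.mk_smul hp hc, ← Omega.mk_rep p]
    simp only [← hz, Omega.mk_rep]
  have hneg := (isPeriod_tubePoint_iff hd z).1 hp
  -- The other summands of `hypPart` are nonnegative, so the hyperbolic term carries the sign. The
  -- two possible sign patterns are the two components, and `swapU` exchanges them.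
  have hprod : (z (.inl (.inr (0, 1)))).im * (z (.inl (.inr (1, 1)))).im < 0 := by
    have h8 := Finset.sum_nonneg fun k (_ : k ∈ Finset.univ) =>
      e8Form_self_nonneg fun i => (z (.inl (.inl (i, (k : Fin 2))))).im
    have h0 := mul_nonneg (Nat.cast_nonneg (α := ℝ) d) (mul_self_nonneg (z (.inr 0)).im)
    rw [hypPart] at hneg
    linarith
  rcases mul_neg_iff.1 hprod with ⟨ha, hb⟩ | ⟨ha, hb⟩
  · exact ⟨z, ⟨ha, hb, hneg⟩, hp, congrArg _ hpe⟩
  · set z' := z ∘ Equiv.swap (Sum.inl (Sum.inr (0, 1)) : DIndex) (.inl (.inr (1, 1))) with hz'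
    have hneg' : hypPart d (fun i => (z' i).im) (fun i => (z' i).im) < 0 := by
      rw [← hypPart_swap] at hneg
      exact hneg
    have hp' := (isPeriod_tubePoint_iff hd z').2 hneg'
    refine ⟨z', ⟨?_, ?_, hneg'⟩, hp', ?_⟩
    · simpa [hz'] using hb
    · simpa [hz'] using ha
    · change (lambdaD d hd).toPeriodSpace p = _
      rw [hpe]
      refine toPeriodSpace_mk_eq (swapU_mem hd) hp hp' ?_
      rw [act_swapU_smul]
      ext i
      have hh : hypPart d z' z' = hypPart d z z := hypPart_swap d z z
      rcases eq_or_ne i (.inl (.inr (0, 1))) with rfl | h₁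
      · simp [hz']
      rcases eq_or_ne i (.inl (.inr (1, 1))) with rfl | h₂
      · simp [hz']
      · simp only [Function.comp_apply, Equiv.swap_apply_of_ne_of_ne h₁ h₂, tubePoint, hh]
        simp only [hz', Function.comp_apply, Equiv.swap_apply_of_ne_of_ne h₁ h₂]

/-! ### Analyticity of special cycles -/

section SpecialCycle

variable {κ : Type} [Fintype κ] [DecidableEq κ]

theorem mem_perp_mk {M : IntLattice κ} {r : ℕ} {v : Fin r → κ → ℚ} {w : κ → ℂ} (hw : M.IsPeriod w) :
    Omega.mk w hw ∈ M.perp v ↔ ∀ i, M.form ℂ (fun a => (v i a : ℂ)) w = 0 := by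
  obtain ⟨a, ha⟩ := Projectivization.exists_smul_eq_mk_rep ℂ w hw.ne_zero
  have h : (Omega.mk w hw).1.rep = (a : ℂ) • w := ha.symm
  simp only [perp, Set.mem_ofPred_eq, h, map_smul, smul_eq_mul, mul_eq_zero, a.ne_zero, false_or]

/-- Near a period, the form is uniformly positive on the real vectors orthogonal to a period. -/
theorem PosOnCodimTwo.exists_uniform_bound {M : IntLattice κ} (hM : M.PosOnCodimTwo) {w : κ → ℂ}
    (hw : M.IsPeriod w) : ∃ U : Set (κ → ℂ), IsOpen U ∧ w ∈ U ∧ ∃ c : ℝ, 0 < c ∧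
      ∀ z ∈ U, M.IsPeriod z → ∀ x : κ → ℝ, M.form ℂ (fun i => (x i : ℂ)) z = 0 →
        c * ‖x‖ ^ 2 ≤ M.form ℝ x x := by
  have hg : Continuous fun z : κ → ℂ => (M.form ℂ z (star z)).re := by
    simp only [form_apply, dotProduct, Matrix.mulVec, Pi.star_apply]
    fun_prop
  set δ := (M.form ℂ w (star w)).re with hδ
  have hδ0 : δ < 0 := hw.2
  -- Weakening `⟨z, z̄⟩ < 0` to the closed condition `≤ δ / 2` keeps every `z` a period and makes
  -- `K` compact. The positive form is then bounded below on `K`, and homogeneity in `x` gives the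
  -- estimate.
  let K : Set ((κ → ℝ) × (κ → ℂ)) := (Metric.sphere 0 1 ×ˢ Metric.closedBall w 1) ∩
    {q | M.form ℂ q.2 q.2 = 0 ∧ (M.form ℂ q.2 (star q.2)).re ≤ δ / 2 ∧
      M.form ℂ (fun i => (q.1 i : ℂ)) q.2 = 0}
  have hK : IsCompact K := by
    refine ((isCompact_sphere _ _).prod (isCompact_closedBall _ _)).inter_right ?_
    refine (isClosed_eq ?_ continuous_const).inter
      ((isClosed_le (hg.comp continuous_snd) continuous_const).inter
        (isClosed_eq ?_ continuous_const))
    · simp only [form_apply, dotProduct, Matrix.mulVec]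
      fun_prop
    · simp only [form_apply, dotProduct, Matrix.mulVec]
      fun_prop
  have hcont : Continuous fun q : (κ → ℝ) × (κ → ℂ) => M.form ℝ q.1 q.1 := by
    simp only [form_apply, dotProduct, Matrix.mulVec]
    fun_prop
  obtain ⟨c, hc, hcK⟩ := hK.exists_forall_le' hcont.continuousOn (a := 0) fun q hq => by
    obtain ⟨⟨hq₁, -⟩, h₁, h₂, h₃⟩ := hq
    refine hM.form_self_pos_of_isPeriod ⟨h₁, by linarith⟩ h₃ ?_
    rintro h
    rw [h] at hq₁
    simp at hq₁
  refine ⟨Metric.ball w 1 ∩ {z | (M.form ℂ z (star z)).re < δ / 2},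
    Metric.isOpen_ball.inter (isOpen_lt hg continuous_const),
    ⟨Metric.mem_ball_self one_pos, ?_⟩, c, hc, fun z hz hzp x hx => ?_⟩
  · change δ < δ / 2
    linarith
  · rcases eq_or_ne x 0 with rfl | hx0
    · simp
    · have hn : ‖x‖ ≠ 0 := norm_ne_zero_iff.2 hx0
      have h := hcK (‖x‖⁻¹ • x, z) ⟨⟨by simp [norm_smul, hn], Metric.ball_subset_closedBall hz.1⟩,
        hzp.1, hz.2.le, by
          have e : (fun i => (((‖x‖⁻¹ • x) i : ℝ) : ℂ)) = ((‖x‖⁻¹ : ℝ) : ℂ) • fun i => (x i : ℂ) := by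
            ext i; simp
          rw [e, map_smul, LinearMap.smul_apply, hx, smul_zero]⟩
      simp only [map_smul, LinearMap.smul_apply, smul_eq_mul] at h
      have h' := mul_le_mul_of_nonneg_left h (sq_nonneg ‖x‖)
      calc c * ‖x‖ ^ 2 = ‖x‖ ^ 2 * c := mul_comm _ _
        _ ≤ _ := h'
        _ = M.form ℝ x x := by field_simp

/-- The tuples of lattice vectors of moment `T`. -/
def latticeTuples (M : IntLattice κ) {r : ℕ} (T : Matrix (Fin r) (Fin r) ℚ) :
    Set (Fin r → κ → ℚ) :=
  {v | (∀ i, v i ∈ M.integral) ∧ M.moment v = T}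

/-- The diagonal of `T` prescribes the norms of the vectors, so the uniform positivity bounds their
integral coordinates. -/
theorem finite_latticeTuples {M : IntLattice κ} {r : ℕ} {T : Matrix (Fin r) (Fin r) ℚ}
    {U : Set (κ → ℂ)} {c : ℝ} (hc : 0 < c)
    (hU : ∀ z ∈ U, M.IsPeriod z → ∀ x : κ → ℝ, M.form ℂ (fun i => (x i : ℂ)) z = 0 →
      c * ‖x‖ ^ 2 ≤ M.form ℝ x x) :
    {v ∈ M.latticeTuples T | ∃ z ∈ U, M.IsPeriod z ∧
      ∀ i, M.form ℂ (fun a => (v i a : ℂ)) z = 0}.Finite := by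
  obtain ⟨B, hB⟩ : ∃ B : ℕ, ∀ i, 2 * (T i i : ℝ) / c ≤ B := by
    obtain ⟨b, hb⟩ := (Set.finite_range fun i => 2 * (T i i : ℝ) / c).bddAbove
    obtain ⟨B, hB⟩ := exists_nat_ge b
    exact ⟨B, fun i => (hb ⟨i, rfl⟩).trans hB⟩
  refine ((Set.finite_Icc (fun _ _ => -(B : ℤ) : Fin r → κ → ℤ) fun _ _ => (B : ℤ)).image
    fun n i a => (n i a : ℚ)).subset ?_
  rintro v ⟨⟨hv, hvT⟩, z, hz, hzp, hvz⟩
  choose n hn using hv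
  have hn' : ∀ i a, v i a = (n i a : ℚ) := fun i a => (congrFun (hn i) a).symm
  have hbound : ∀ i a, |n i a| ≤ (B : ℤ) := fun i a => by
    have h₁ := hU z hz hzp (fun a => (n i a : ℝ)) (by
      rw [← hvz i]; simp [hn'])
    have h₂ : M.form ℝ (fun a => (n i a : ℝ)) (fun a => (n i a : ℝ)) = 2 * (T i i : ℝ) := by
      have h := M.map_form (Rat.castHom ℝ) (v i) (v i)
      have h' : M.form ℚ (v i) (v i) = 2 * T i i := by
        rw [← hvT, moment, Matrix.of_apply]; ring
      rw [h'] at h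
      simpa [hn'] using h.symm
    rw [h₂] at h₁
    have h₃ : ‖(fun a => (n i a : ℝ))‖ ^ 2 ≤ B :=
      le_trans (by rw [le_div_iff₀ hc]; linarith) (hB i)
    have h₄ : |(n i a : ℝ)| ≤ ‖(fun a => (n i a : ℝ))‖ := norm_le_pi_norm (fun a => (n i a : ℝ)) a
    have h₅ : |(n i a : ℝ)| ^ 2 ≤ B := (pow_le_pow_left₀ (abs_nonneg _) h₄ 2).trans h₃
    have h₆ : |n i a| ^ 2 ≤ (B : ℤ) := by exact_mod_cast h₅
    nlinarith [abs_nonneg (n i a), sq_nonneg (|n i a| - 1)]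
  exact ⟨n, ⟨fun i a => (abs_le.1 (hbound i a)).1, fun i a => (abs_le.1 (hbound i a)).2⟩,
    funext fun i => funext fun a => (hn' i a).symm⟩

/-- Near a period only a finite set `F` of tuples contributes. The finite union of their common zero
loci is cut out by the products that take one linear form from each tuple, one product for every
choice function `F → Fin r`. -/
theorem isAnalyticInOmega_iUnion_perp {M : IntLattice κ} (hM : M.PosOnCodimTwo) {r : ℕ}
    {T : Matrix (Fin r) (Fin r) ℚ} {𝒱 : Set (Fin r → κ → ℚ)} (h𝒱 : 𝒱 ⊆ M.latticeTuples T) :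
    M.IsAnalyticInOmega (⋃ v ∈ 𝒱, M.perp v) := by
  intro w hw
  obtain ⟨U, hU, hwU, c, hc, hUc⟩ := hM.exists_uniform_bound hw
  refine ⟨U, hU, hwU, ?_⟩
  have hF : {v ∈ 𝒱 | ∃ z ∈ U, M.IsPeriod z ∧
      ∀ i, M.form ℂ (fun a => (v i a : ℂ)) z = 0}.Finite :=
    (finite_latticeTuples (T := T) hc hUc).subset fun v hv => ⟨h𝒱 hv.1, hv.2⟩
  set F := {v ∈ 𝒱 | ∃ z ∈ U, M.IsPeriod z ∧ ∀ i, M.form ℂ (fun a => (v i a : ℂ)) z = 0} with hFdef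
  have := hF.fintype
  classical
  let e := Fintype.equivFin (F → Fin r)
  refine ⟨_, fun k z => ∏ v : F, M.form ℂ (fun a => (v.1 (e.symm k v) a : ℂ)) z,
    fun k z _ => ?_, fun z hz hzU => ?_⟩
  · refine Finset.analyticAt_fun_prod _ fun v _ => ?_
    exact (LinearMap.toContinuousLinearMap (M.form ℂ _)).analyticAt z
  · simp only [Set.mem_iUnion, mem_perp_mk, exists_prop]
    constructor
    · rintro ⟨v, hv, hvz⟩ k
      exact Finset.prod_eq_zero (Finset.mem_univ (⟨v, hv, z, hzU, hz, hvz⟩ : F)) (hvz _)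
    · intro h
      by_contra! hne
      choose i hi using fun v : F => hne v.1 v.2.1
      have hk := h (e i)
      rw [Finset.prod_eq_zero_iff] at hk
      obtain ⟨v, -, hv⟩ := hk
      rw [Equiv.symm_apply_apply] at hv
      exact hi v hv

/-! ### The action of `Γ_M` on periods, tuples and their loci -/

theorem form_act {M : IntLattice κ} {g : GL κ ℤ} (hg : g ∈ M.monodromyGroup) (R : Type)
    [CommRing R] (x y : κ → R) : M.form R (act R g • x) (act R g • y) = M.form R x y := by
  have hc : ∀ A : Matrix κ κ ℤ, A.map (Int.castRingHom ℤ) = A := fun A => by ext; simp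
  have hm : (g : Matrix κ κ ℤ)ᵀ * M.gram * (g : Matrix κ κ ℤ) = M.gram := by
    ext a b
    have h := hg.1 (Pi.single a 1) (Pi.single b 1)
    rw [form_apply, form_apply, act_smul, act_smul, hc, hc, Matrix.mulVec_mulVec,
      ← Matrix.vecMul_transpose, ← Matrix.dotProduct_mulVec, Matrix.mulVec_mulVec,
      ← Matrix.mul_assoc] at h
    simpa using h
  rw [form_apply, form_apply, act_smul, act_smul, Matrix.mulVec_mulVec, ← Matrix.vecMul_transpose,
    ← Matrix.dotProduct_mulVec, Matrix.mulVec_mulVec, ← Matrix.mul_assoc, ← Matrix.transpose_map,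
    ← Matrix.map_mul, ← Matrix.map_mul, hm]

theorem act_ratCast (g : GL κ ℤ) (x : κ → ℚ) :
    (fun a => (((act ℚ g • x) a : ℚ) : ℂ)) = act ℂ g • fun a => (x a : ℂ) := by
  ext a
  simp [act_smul, Matrix.mulVec, dotProduct]

theorem isPeriod_act {M : IntLattice κ} {g : GL κ ℤ} (hg : g ∈ M.monodromyGroup) {w : κ → ℂ}
    (hw : M.IsPeriod w) : M.IsPeriod (act ℂ g • w) := by
  have h : star (act ℂ g • w) = act ℂ g • star w := by
    ext a
    simp [act_smul, Matrix.mulVec, dotProduct]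
  rw [IsPeriod, h, form_act hg, form_act hg]
  exact hw

/-- The group `Γ_M` acts on `Ω(M)`. -/
theorem exists_act_smul_eq {M : IntLattice κ} {g : GL κ ℤ} (hg : g ∈ M.monodromyGroup)
    (p : M.Omega) : ∃ q : M.Omega, act ℂ g • p.1 = q.1 := by
  refine ⟨Omega.mk _ (isPeriod_act hg p.2), ?_⟩
  conv_lhs => rw [← Projectivization.mk_rep p.1]
  exact Projectivization.smul_mk ..

theorem perp_act {M : IntLattice κ} {g : GL κ ℤ} (hg : g ∈ M.monodromyGroup) {r : ℕ}
    {v : Fin r → κ → ℚ} {p q : M.Omega} (hp : p ∈ M.perp v) (hpq : act ℂ g • p.1 = q.1) :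
    q ∈ M.perp fun i => act ℚ g • v i := by
  have h0 : act ℂ g • p.1.rep ≠ 0 := (smul_ne_zero_iff_ne _).2 p.2.ne_zero
  have hq : q.1 = Projectivization.mk ℂ (act ℂ g • p.1.rep) h0 := by
    rw [← hpq]
    conv_lhs => rw [← Projectivization.mk_rep p.1]
    exact Projectivization.smul_mk ..
  have hq' : q = Omega.mk _ (isPeriod_act hg p.2) := Subtype.ext hq
  rw [hq', mem_perp_mk]
  intro i
  rw [act_ratCast, form_act hg]
  exact hp i

theorem act_mem_latticeTuples {M : IntLattice κ} {g : GL κ ℤ} (hg : g ∈ M.monodromyGroup) {r : ℕ}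
    {T : Matrix (Fin r) (Fin r) ℚ} {v : Fin r → κ → ℚ} (hv : v ∈ M.latticeTuples T) :
    (fun i => act ℚ g • v i) ∈ M.latticeTuples T := by
  refine ⟨fun i => M.act_integral g (hv.1 i), ?_⟩
  rw [← hv.2]
  ext i k
  simp only [moment, Matrix.of_apply, form_act hg]

/-- A `Γ_M`-stable family has a saturated union of loci, so analyticity of its image can be checked
on that union. -/
theorem preimage_image_iUnion_perp {M : IntLattice κ} {r : ℕ} {𝒱 : Set (Fin r → κ → ℚ)}
    (h𝒱 : ∀ g ∈ M.monodromyGroup, ∀ v ∈ 𝒱, (fun i => act ℚ g • v i) ∈ 𝒱) :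
    M.toPeriodSpace ⁻¹' (M.toPeriodSpace '' ⋃ v ∈ 𝒱, M.perp v) = ⋃ v ∈ 𝒱, M.perp v := by
  refine Set.Subset.antisymm ?_ (Set.subset_preimage_image _ _)
  rintro q ⟨p, hp, hpq⟩
  obtain ⟨g, hg, h⟩ := Quotient.exact hpq
  simp only [Set.mem_iUnion, exists_prop] at hp ⊢
  obtain ⟨v, hv, hpv⟩ := hp
  exact ⟨_, h𝒱 g hg v hv, perp_act hg hpv h⟩

theorem isAnalytic_image_iUnion_perp {M : IntLattice κ} (hM : M.PosOnCodimTwo) {r : ℕ}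
    {T : Matrix (Fin r) (Fin r) ℚ} {𝒱 : Set (Fin r → κ → ℚ)} (h𝒱 : 𝒱 ⊆ M.latticeTuples T)
    (h𝒱' : ∀ g ∈ M.monodromyGroup, ∀ v ∈ 𝒱, (fun i => act ℚ g • v i) ∈ 𝒱) :
    M.IsAnalytic (M.toPeriodSpace '' ⋃ v ∈ 𝒱, M.perp v) := by
  rw [IsAnalytic, preimage_image_iUnion_perp h𝒱']
  exact isAnalyticInOmega_iUnion_perp hM h𝒱

theorem integral_le_dual (M : IntLattice κ) : M.integral ≤ M.dual := by
  rintro _ ⟨x, rfl⟩ _ ⟨y, rfl⟩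
  exact Submodule.mem_one.2 ⟨M.form ℤ x y, M.map_form (Int.castRingHom ℚ) x y⟩

theorem specialCycle_zero (M : IntLattice κ) {r : ℕ} (T : Matrix (Fin r) (Fin r) ℚ) :
    M.specialCycle T 0 = M.toPeriodSpace '' ⋃ v ∈ M.latticeTuples T, M.perp v := by
  rw [specialCycle]
  congr 1
  ext p
  simp only [Set.mem_iUnion, exists_prop, Set.mem_ofPred_eq]
  constructor
  · rintro ⟨v, ⟨hT, hv⟩, hp⟩
    refine ⟨fun i => v i, ⟨fun i => ?_, hT⟩, hp⟩
    have h := (Submodule.Quotient.mk_eq_zero (M.integral.submoduleOf M.dual)).1 (hv i)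
    exact h
  · rintro ⟨v, ⟨hv, hT⟩, hp⟩
    exact ⟨fun i => ⟨v i, M.integral_le_dual (hv i)⟩,
      ⟨hT, fun i => (Submodule.Quotient.mk_eq_zero _).2 (hv i)⟩, hp⟩

end SpecialCycle

/-! ### Irreducibility of the image of `𝓟_d` -/

section Image

variable {κ : Type} [Fintype κ] [DecidableEq κ] {M : IntLattice κ} {d : ℕ} {hd : 0 < d}

namespace PrimitiveEmbedding

theorem periodMap_toPeriodSpace {ι : Type} [Fintype ι] [DecidableEq ι] {L : IntLattice ι}
    (j : PrimitiveEmbedding L M) {w : ι → ℂ} (hw : L.IsPeriod w) :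
    j.periodMap (L.toPeriodSpace (Omega.mk w hw)) =
      M.toPeriodSpace (Omega.mk (j.complexify w) (j.isPeriod_complexify hw)) := by
  rw [← omegaMap_mk]; rfl

/-- The points of the tube domain that map to a given subset of `Ω(M)`. -/
def tubePreimage (j : PrimitiveEmbedding (lambdaD d hd) M) (A : Set M.Omega) : Set (DIndex → ℂ) :=
  {z | ∃ h : M.IsPeriod (j.complexify (tubePoint d z)), Omega.mk (j.complexify (tubePoint d z)) h ∈ A}

theorem isPeriod_complexify_tubePoint (j : PrimitiveEmbedding (lambdaD d hd) M) {z : DIndex → ℂ}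
    (hz : z ∈ tubeDomain d) : M.IsPeriod (j.complexify (tubePoint d z)) :=
  j.isPeriod_complexify ((isPeriod_tubePoint_iff hd z).2 hz.2.2)

theorem locallyZeroLocus_tubePreimage (j : PrimitiveEmbedding (lambdaD d hd) M) {A : Set M.Omega}
    (hA : M.IsAnalyticInOmega A) : LocallyZeroLocus (tubeDomain d) (j.tubePreimage A) :=
  hA.locallyZeroLocus (fun z => ((LinearMap.toContinuousLinearMap j.complexify).analyticAt _).comp
    (analyticAt_tubePoint d z)) fun _ hz => j.isPeriod_complexify_tubePoint hz

/-- The tube domain surjects onto `𝓟_d`, so containments of the image become containments of a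
connected open subset of a vector space. -/
theorem range_periodMap_subset_iff (j : PrimitiveEmbedding (lambdaD d hd) M)
    {A : Set M.PeriodSpace} : Set.range j.periodMap ⊆ A ↔
      tubeDomain d ⊆ j.tubePreimage (M.toPeriodSpace ⁻¹' A) := by
  constructor
  · intro h z hz
    refine ⟨j.isPeriod_complexify_tubePoint hz, ?_⟩
    rw [Set.mem_preimage, ← periodMap_toPeriodSpace j ((isPeriod_tubePoint_iff hd z).2 hz.2.2)]
    exact h ⟨_, rfl⟩
  · rintro h _ ⟨x, rfl⟩
    obtain ⟨z, hz, hp, rfl⟩ := exists_mem_tubeDomain hd x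
    rw [periodMap_toPeriodSpace]
    exact (h hz).2

theorem range_periodMap_nonempty (j : PrimitiveEmbedding (lambdaD d hd) M) :
    (Set.range j.periodMap).Nonempty :=
  ⟨_, (lambdaD d hd).toPeriodSpace
    (Omega.mk _ ((isPeriod_tubePoint_iff hd _).2 (tubeBase_mem d).2.2)), rfl⟩

/-- The image of `𝓟_d` is not a union of two analytic subsets in a nontrivial way. -/
theorem range_periodMap_subset_or (j : PrimitiveEmbedding (lambdaD d hd) M)
    {A B : Set M.PeriodSpace} (hA : M.IsAnalytic A) (hB : M.IsAnalytic B)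
    (h : Set.range j.periodMap ⊆ A ∪ B) :
    Set.range j.periodMap ⊆ A ∨ Set.range j.periodMap ⊆ B := by
  simp only [range_periodMap_subset_iff] at h ⊢
  refine (j.locallyZeroLocus_tubePreimage hA).subset_or_subset (isOpen_tubeDomain d)
    (isPreconnected_tubeDomain d) ⟨_, tubeBase_mem d⟩ (j.locallyZeroLocus_tubePreimage hB)
    fun z hz => ?_
  obtain ⟨hp, hz' | hz'⟩ := h hz
  · exact .inl ⟨hp, hz'⟩
  · exact .inr ⟨hp, hz'⟩

/-- If the image of `𝓟_d` is covered by the loci orthogonal to the tuples in `𝒱`, then some tuple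
in `𝒱` is orthogonal to `Λ_d`. -/
theorem exists_orthogonal_of_range_subset (j : PrimitiveEmbedding (lambdaD d hd) M)
    (hM : M.PosOnCodimTwo) {r : ℕ} {T : Matrix (Fin r) (Fin r) ℚ} {𝒱 : Set (Fin r → κ → ℚ)}
    (h𝒱 : 𝒱 ⊆ M.latticeTuples T)
    (h𝒱' : ∀ g ∈ M.monodromyGroup, ∀ v ∈ 𝒱, (fun i => act ℚ g • v i) ∈ 𝒱)
    (h : Set.range j.periodMap ⊆ M.toPeriodSpace '' ⋃ v ∈ 𝒱, M.perp v) :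
    ∃ v ∈ 𝒱, ∀ i, ((j.matᵀ * M.gram).map (Int.castRingHom ℚ)) *ᵥ v i = 0 := by
  rw [range_periodMap_subset_iff, preimage_image_iUnion_perp h𝒱'] at h
  have hcov : tubeDomain d ⊆ ⋃ v : 𝒱, j.tubePreimage (M.perp v.1) := by
    intro z hz
    obtain ⟨hp, hz⟩ := h hz
    simp only [Set.mem_iUnion, exists_prop] at hz ⊢
    obtain ⟨v, hv, hz⟩ := hz
    exact ⟨⟨v, hv⟩, hp, hz⟩
  -- There are only countably many tuples of rational vectors, and each locus alone is analytic, so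
  -- one of them contains the whole tube domain.
  obtain ⟨⟨v, hv⟩, hvD⟩ := LocallyZeroLocus.exists_subset_of_subset_iUnion (isOpen_tubeDomain d)
    (isPreconnected_tubeDomain d) ⟨_, tubeBase_mem d⟩
    (fun v : 𝒱 => j.locallyZeroLocus_tubePreimage (by
      have := isAnalyticInOmega_iUnion_perp hM (Set.singleton_subset_iff.2 (h𝒱 v.2))
      rwa [Set.biUnion_singleton] at this)) hcov
  refine ⟨v, hv, fun i => ?_⟩
  have h0 : ((j.matᵀ * M.gram).map (Int.castRingHom ℂ)) *ᵥ (fun a => (v i a : ℂ)) = 0 := by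
    refine eq_zero_of_dotProduct_tubePoint (d := d) fun z hz => ?_
    obtain ⟨hp, hzp⟩ := hvD hz
    have hi := (mem_perp_mk hp).1 hzp i
    rw [form_comm, form_apply, complexify_apply, ← Matrix.vecMul_transpose,
      ← Matrix.dotProduct_mulVec, Matrix.mulVec_mulVec, ← Matrix.transpose_map, ← Matrix.map_mul,
      dotProduct_comm] at hi
    exact hi
  ext a
  have ha := congrFun h0 a
  have : (((((j.matᵀ * M.gram).map (Int.castRingHom ℚ)) *ᵥ v i) a : ℚ) : ℂ) = 0 := by
    rw [Pi.zero_apply] at ha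
    rw [← ha]
    simp [Matrix.mulVec, dotProduct]
  exact_mod_cast this

end PrimitiveEmbedding

end Image

/-! ### The image of the period map as a special locus -/

section Locus

variable {ι κ : Type} [Fintype ι] [DecidableEq ι] [Fintype κ] [DecidableEq κ]
variable {L : IntLattice ι} {M : IntLattice κ}

/-- The columns of an integral matrix, as rational vectors. -/
def columns {r : ℕ} (V : Matrix κ (Fin r) ℤ) : Fin r → κ → ℚ := fun i a => V a i

theorem moment_columns (M : IntLattice κ) {r : ℕ} (V : Matrix κ (Fin r) ℤ) :
    M.moment (columns V) = (1 / 2 : ℚ) • (Vᵀ * M.gram * V).map (Int.castRingHom ℚ) := by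
  ext i k
  have h : ((Vᵀ * M.gram * V) i k) = M.form ℤ (fun a => V a i) fun a => V a k := by
    rw [form_apply, Matrix.mul_assoc]
    have : M.gram.map (Int.castRingHom ℤ) = M.gram := by ext; simp
    rw [this]
    simp [Matrix.mul_apply, dotProduct, Matrix.mulVec]
  have h' := M.map_form (Int.castRingHom ℚ) (fun a => V a i) fun a => V a k
  simp only [moment, Matrix.of_apply, Matrix.smul_apply, Matrix.map_apply, h, h', smul_eq_mul]
  rw [mul_comm, mul_one_div]
  rfl

theorem columns_mem_latticeTuples (M : IntLattice κ) {r : ℕ} (V : Matrix κ (Fin r) ℤ) :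
    columns V ∈ M.latticeTuples (M.moment (columns V)) :=
  ⟨fun i => ⟨fun a => V a i, rfl⟩, rfl⟩

theorem mem_perp_columns_iff {r : ℕ} (V : Matrix κ (Fin r) ℤ) (p : M.Omega) :
    p ∈ M.perp (columns V) ↔ ((Vᵀ * M.gram).map (Int.castRingHom ℂ)) *ᵥ p.1.rep = 0 := by
  have h : ∀ i, M.form ℂ (fun a => (columns V i a : ℂ)) p.1.rep =
      (((Vᵀ * M.gram).map (Int.castRingHom ℂ)) *ᵥ p.1.rep) i := fun i => by
    rw [form_apply, Matrix.map_mul, ← Matrix.mulVec_mulVec]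
    simp [columns, Matrix.mulVec, dotProduct]
  simp only [perp, Set.mem_ofPred_eq, h]
  exact ⟨fun h => funext h, fun h i => congrFun h i⟩

/-- The identity `hDC` says that the complexified sublattice is the full complement of `V`: a vector
`p` killed by `Vᵀ * M.gram` equals `j (D p)`. -/
theorem PrimitiveEmbedding.range_periodMap (j : PrimitiveEmbedding L M) {r : ℕ}
    {V : Matrix κ (Fin r) ℤ} {D : Matrix ι κ ℤ} {C : Matrix κ (Fin r) ℤ}
    (hV : Vᵀ * M.gram * j.mat = 0) (hDC : j.mat * D + C * (Vᵀ * M.gram) = 1) :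
    Set.range j.periodMap = M.toPeriodSpace '' M.perp (columns V) := by
  have hrange : Set.range j.omegaMap = M.perp (columns V) := by
    ext p
    rw [mem_perp_columns_iff]
    constructor
    · rintro ⟨q, rfl⟩
      rw [← mem_perp_columns_iff, omegaMap, mem_perp_mk]
      have h := congrArg (fun X => (X.map (Int.castRingHom ℂ)) *ᵥ q.1.rep) hV
      rw [Matrix.map_mul, ← Matrix.mulVec_mulVec, ← complexify_apply, Matrix.map_mul,
        ← Matrix.mulVec_mulVec] at h
      intro i
      rw [form_apply]
      have hi := congrFun h i
      simpa [columns, Matrix.mulVec, dotProduct] using hi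
    · intro hp
      have h := congrArg (fun X => (X.map (Int.castRingHom ℂ)) *ᵥ p.1.rep) hDC
      rw [Matrix.map_add _ (map_add _), Matrix.add_mulVec, Matrix.map_mul, Matrix.map_mul (L := C),
        ← Matrix.mulVec_mulVec, ← Matrix.mulVec_mulVec, hp, Matrix.mulVec_zero, add_zero,
        ← complexify_apply, Matrix.map_one _ (map_zero _) (map_one _), Matrix.one_mulVec] at h
      set w := (D.map (Int.castRingHom ℂ)) *ᵥ p.1.rep with hw
      have hper := p.2
      have hwp : L.IsPeriod w := by
        rw [IsPeriod, ← j.form_complexify, ← j.form_complexify, ← star_complexify, h]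
        exact hper
      refine ⟨Omega.mk w hwp, ?_⟩
      rw [omegaMap_mk]
      conv_rhs => rw [← Omega.mk_rep p]
      congr 1
  rw [← hrange, ← Set.range_comp]
  ext x
  constructor
  · rintro ⟨y, rfl⟩
    obtain ⟨q, rfl⟩ := Quotient.exists_rep y
    exact ⟨q, rfl⟩
  · rintro ⟨q, rfl⟩
    exact ⟨L.toPeriodSpace q, rfl⟩

/-- A tuple of the same nondegenerate moment as a basis of `L^⊥`, orthogonal to `L`, has the same
orthogonal complement. -/
theorem PrimitiveEmbedding.perp_subset_perp_columns (j : PrimitiveEmbedding L M) {r : ℕ}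
    {V : Matrix κ (Fin r) ℤ} {W : Matrix (Fin r) κ ℤ} {E : Matrix κ ι ℤ}
    (hVW : V * W + E * (j.matᵀ * M.gram) = 1) (hT : (M.moment (columns V)).det ≠ 0)
    {v : Fin r → κ → ℚ} (hv : M.moment v = M.moment (columns V))
    (hvj : ∀ i, ((j.matᵀ * M.gram).map (Int.castRingHom ℚ)) *ᵥ v i = 0) :
    M.perp v ⊆ M.perp (columns V) := by
  let N : Matrix κ (Fin r) ℚ := Matrix.of fun a i => v i a
  set c := Int.castRingHom ℚ with hc
  set H := M.gram.map c with hH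
  set A := W.map c * N with hA
  have hJN : (j.matᵀ * M.gram).map c * N = 0 := by
    ext a i
    exact congrFun (hvj i) a
  -- The identity `hVW` expresses any vector orthogonal to the sublattice through the columns of
  -- `V`. Equality of moments then reads `T = Aᵀ * T * A`, and `det T ≠ 0` forces `A` to be
  -- invertible.
  have hN : N = V.map c * A := by
    have h := congrArg (fun X => X.map c * N) hVW
    rw [Matrix.map_add _ (map_add c), Matrix.add_mul, Matrix.map_mul, Matrix.map_mul (L := E),
      Matrix.mul_assoc _ _ N, Matrix.mul_assoc _ _ N, hJN, Matrix.mul_zero, add_zero,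
      Matrix.map_one _ (map_zero c) (map_one c), Matrix.one_mul] at h
    exact h.symm
  clear_value A
  have hmom : ∀ (u : Fin r → κ → ℚ) (X : Matrix κ (Fin r) ℚ), (∀ a i, X a i = u i a) →
      M.moment u = (1 / 2 : ℚ) • (Xᵀ * H * X) := fun u X hX => by
    ext i k
    rw [moment, Matrix.of_apply, form_apply, Matrix.smul_apply, Matrix.mul_assoc, smul_eq_mul,
      one_div, inv_mul_eq_div]
    simp [Matrix.mul_apply, dotProduct, Matrix.mulVec, hX, hH, hc]
  have hTA : M.moment (columns V) = Aᵀ * M.moment (columns V) * A := by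
    conv_lhs => rw [← hv, hmom v N fun _ _ => rfl]
    rw [hmom (columns V) (V.map c) fun _ _ => rfl, hN]
    simp only [Matrix.transpose_mul, Matrix.mul_smul, Matrix.smul_mul, Matrix.mul_assoc]
  have hAdet : A.det ≠ 0 := fun h0 => by
    have h := congrArg Matrix.det hTA
    rw [Matrix.det_mul, h0, mul_zero] at h
    exact hT h
  intro p hp
  rw [mem_perp_columns_iff]
  have hAc : (A.map (Rat.castHom ℂ))ᵀ.det ≠ 0 := by
    rw [Matrix.det_transpose, ← RingHom.mapMatrix_apply, ← RingHom.map_det]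
    simpa using hAdet
  refine Matrix.eq_zero_of_mulVec_eq_zero hAc ?_
  have hNp : (N.map (Rat.castHom ℂ))ᵀ *ᵥ (M.gram.map (Int.castRingHom ℂ) *ᵥ p.1.rep) = 0 := by
    ext i
    have hi := hp i
    rw [form_apply] at hi
    exact hi
  have hVc : (V.map c).map (Rat.castHom ℂ) = V.map (Int.castRingHom ℂ) := by
    ext; simp [hc]
  rw [hN, Matrix.map_mul, hVc, Matrix.transpose_mul, ← Matrix.mulVec_mulVec] at hNp
  rw [Matrix.map_mul, ← Matrix.mulVec_mulVec, ← Matrix.transpose_map]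
  exact hNp

/-- The orthogonal complement of a sublattice containing a negative definite plane is positive
definite. -/
theorem PrimitiveEmbedding.complement_pos (j : PrimitiveEmbedding L M)
    (hM : M.PosOnCodimTwo) {n₁ n₂ : ι → ℝ} (h₁ : L.form ℝ n₁ n₁ < 0) (h₂ : L.form ℝ n₂ n₂ < 0)
    (h₁₂ : L.form ℝ n₁ n₂ = 0) {r : ℕ} {V : Matrix κ (Fin r) ℤ} {W : Matrix (Fin r) κ ℤ}
    (hV : Vᵀ * M.gram * j.mat = 0) (hWV : W * V = 1) {x : Fin r → ℝ} (hx : x ≠ 0) :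
    0 < x ⬝ᵥ (Vᵀ * M.gram * V).map (Int.castRingHom ℝ) *ᵥ x := by
  set c := Int.castRingHom ℝ with hc
  have hform : ∀ {σ τ : Type} [Fintype σ] [Fintype τ] (X : Matrix κ σ ℤ) (Y : Matrix κ τ ℤ)
      (x : σ → ℝ) (y : τ → ℝ), M.form ℝ (X.map c *ᵥ x) (Y.map c *ᵥ y) =
        x ⬝ᵥ (Xᵀ * M.gram * Y).map c *ᵥ y := fun X Y x y => by
    rw [form_apply, Matrix.mulVec_mulVec, ← Matrix.vecMul_transpose, ← Matrix.dotProduct_mulVec,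
      Matrix.mulVec_mulVec, ← Matrix.mul_assoc, ← Matrix.transpose_map, ← Matrix.map_mul,
      ← Matrix.map_mul]
  have hJ : ∀ y z : ι → ℝ, M.form ℝ (j.mat.map c *ᵥ y) (j.mat.map c *ᵥ z) = L.form ℝ y z :=
    fun y z => by rw [hform, j.mat_isometry, form_apply]
  have hVJ : ∀ y : ι → ℝ, M.form ℝ (V.map c *ᵥ x) (j.mat.map c *ᵥ y) = 0 := fun y => by
    rw [hform, hV]; simp
  rw [← hform]
  refine hM.form_self_pos (n₁ := j.mat.map c *ᵥ n₁) (n₂ := j.mat.map c *ᵥ n₂) (by rwa [hJ])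
    (by rwa [hJ]) (by rwa [hJ]) (hVJ _) (hVJ _) fun h0 => hx ?_
  have h := congrArg (fun X => X.map c *ᵥ x) hWV
  rw [Matrix.map_mul, ← Matrix.mulVec_mulVec, h0, Matrix.mulVec_zero,
    Matrix.map_one _ (map_zero c) (map_one c), Matrix.one_mulVec] at h
  exact h.symm

theorem posDef_map_real {r : ℕ} {S : Matrix (Fin r) (Fin r) ℤ} (hS : S.IsSymm)
    (h : ∀ x : Fin r → ℝ, x ≠ 0 → 0 < x ⬝ᵥ S.map (Int.castRingHom ℝ) *ᵥ x) :
    (S.map (Int.castRingHom ℚ)).PosDef ∧ 0 < S.det := by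
  constructor
  · refine Matrix.PosDef.of_dotProduct_mulVec_pos ?_ fun x hx => ?_
    · ext i k
      simp [hS.apply i k]
    · have h' := h (fun i => (x i : ℝ)) fun h0 => hx (funext fun i => by
        have := congrFun h0 i
        simpa using this)
      have e : ((x ⬝ᵥ S.map (Int.castRingHom ℚ) *ᵥ x : ℚ) : ℝ) =
          (fun i => (x i : ℝ)) ⬝ᵥ S.map (Int.castRingHom ℝ) *ᵥ fun i => (x i : ℝ) := by
        simp [dotProduct, Matrix.mulVec]
      rw [← e] at h'
      simpa using h'
  · have hp : (S.map (Int.castRingHom ℝ)).PosDef := by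
      refine Matrix.PosDef.of_dotProduct_mulVec_pos ?_ fun x hx => by simpa using h x hx
      ext i k
      simp [hS.apply i k]
    have h' := hp.det_pos
    rw [← RingHom.mapMatrix_apply, ← RingHom.map_det] at h'
    simpa using h'

end Locus

/-! ### The image of `𝓟_d` as an irreducible component -/

theorem exists_negative_plane {d : ℕ} (hd : 0 < d) : ∃ n₁ n₂ : DIndex → ℝ,
    (lambdaD d hd).form ℝ n₁ n₁ < 0 ∧ (lambdaD d hd).form ℝ n₂ n₂ < 0 ∧
      (lambdaD d hd).form ℝ n₁ n₂ = 0 := by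
  obtain ⟨h₁, h₂, h₁₂⟩ := ((isPeriod_tubePoint_iff hd tubeBase).2 (tubeBase_mem d).2.2).re_im
  exact ⟨_, _, h₁, h₂, h₁₂⟩

/-- The locus orthogonal to a basis of the complement of `Λ_d` is an irreducible component of the
special cycle. -/
theorem PrimitiveEmbedding.isIrreducibleComponent {κ : Type} [Fintype κ] [DecidableEq κ]
    {M : IntLattice κ} {d : ℕ} {hd : 0 < d} (j : PrimitiveEmbedding (lambdaD d hd) M)
    (hM : M.PosOnCodimTwo) {r : ℕ} {V : Matrix κ (Fin r) ℤ} {W : Matrix (Fin r) κ ℤ}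
    {E : Matrix κ DIndex ℤ} {D : Matrix DIndex κ ℤ} {C : Matrix κ (Fin r) ℤ}
    (hV : Vᵀ * M.gram * j.mat = 0) (hVW : V * W + E * (j.matᵀ * M.gram) = 1)
    (hDC : j.mat * D + C * (Vᵀ * M.gram) = 1) (hT : (M.moment (columns V)).det ≠ 0) :
    M.IsIrreducibleComponent (Set.range j.periodMap) (M.specialCycle (M.moment (columns V)) 0) := by
  set T := M.moment (columns V) with hTdef
  -- The `Γ_M`-orbit of the basis is a stable family with the same image as the basis alone; this
  -- makes the image of `𝓟_d` analytic.
  set 𝒞 : Set (Fin r → κ → ℚ) :=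
    {v | ∃ g ∈ M.monodromyGroup, v = fun i => act ℚ g • columns V i} with h𝒞
  have h𝒞T : 𝒞 ⊆ M.latticeTuples T := by
    rintro _ ⟨g, hg, rfl⟩
    exact act_mem_latticeTuples hg (columns_mem_latticeTuples M V)
  have h𝒞act : ∀ g ∈ M.monodromyGroup, ∀ v ∈ 𝒞, (fun i => act ℚ g • v i) ∈ 𝒞 := by
    rintro g hg _ ⟨g', hg', rfl⟩
    exact ⟨g * g', mul_mem hg hg', by simp only [map_mul, mul_smul]⟩
  have hrange := j.range_periodMap hV hDC
  have hC : Set.range j.periodMap = M.toPeriodSpace '' ⋃ v ∈ 𝒞, M.perp v := by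
    rw [hrange]
    refine Set.Subset.antisymm (Set.image_mono ?_) ?_
    · exact Set.subset_biUnion_of_mem (u := fun v => M.perp v)
        ⟨1, one_mem _, by simp only [map_one, one_smul]⟩
    · rintro _ ⟨q, hq, rfl⟩
      simp only [Set.mem_iUnion, exists_prop] at hq
      obtain ⟨_, ⟨g, hg, rfl⟩, hq⟩ := hq
      obtain ⟨q', hq'⟩ := exists_act_smul_eq (inv_mem hg) q
      have h := perp_act (inv_mem hg) hq hq'
      simp only [map_inv, inv_smul_smul] at h
      exact ⟨q', h, (Quotient.sound ⟨g⁻¹, inv_mem hg, hq'⟩ : M.toPeriodSpace q = _).symm⟩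
  -- The family is selected by its loci rather than as the complement of the orbit `𝒞`: tuples
  -- outside `𝒞`, such as other rational bases of the complement, may also have their locus over the
  -- image.
  set ℬ : Set (Fin r → κ → ℚ) :=
    {v ∈ M.latticeTuples T | ¬ M.perp v ⊆ M.toPeriodSpace ⁻¹' Set.range j.periodMap} with hℬ
  have hℬT : ℬ ⊆ M.latticeTuples T := fun v hv => hv.1
  have hℬact : ∀ g ∈ M.monodromyGroup, ∀ v ∈ ℬ, (fun i => act ℚ g • v i) ∈ ℬ := by
    rintro g hg v ⟨hv, hvC⟩
    refine ⟨act_mem_latticeTuples hg hv, fun h => hvC fun p hp => ?_⟩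
    obtain ⟨q, hq⟩ := exists_act_smul_eq hg p
    have e : M.toPeriodSpace p = M.toPeriodSpace q := Quotient.sound ⟨g, hg, hq⟩
    rw [Set.mem_preimage, e]
    exact h (perp_act hg hp hq)
  have hCan : M.IsAnalytic (Set.range j.periodMap) := by
    rw [hC]; exact isAnalytic_image_iUnion_perp hM h𝒞T h𝒞act
  have hBan := isAnalytic_image_iUnion_perp hM hℬT hℬact
  have hZ := M.specialCycle_zero T
  refine ⟨?_, ⟨⟨hCan, j.range_periodMap_nonempty, fun A B hA hB h =>
    j.range_periodMap_subset_or hA hB h⟩, ?_⟩, ?_⟩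
  · rw [hZ]
    exact isAnalytic_image_iUnion_perp hM subset_rfl fun g hg v hv => act_mem_latticeTuples hg hv
  · rw [hZ, hC]
    exact Set.image_mono (Set.biUnion_mono h𝒞T fun _ _ => subset_rfl)
  · rintro S ⟨⟨-, -, hS⟩, hSZ⟩ hCS
    have hcov : S ⊆ Set.range j.periodMap ∪ M.toPeriodSpace '' ⋃ v ∈ ℬ, M.perp v := by
      intro x hx
      have hxZ := hSZ hx
      rw [hZ] at hxZ
      obtain ⟨p, hp, rfl⟩ := hxZ
      simp only [Set.mem_iUnion, exists_prop] at hp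
      obtain ⟨v, hv, hp⟩ := hp
      by_cases hvC : M.perp v ⊆ M.toPeriodSpace ⁻¹' Set.range j.periodMap
      · exact .inl (hvC hp)
      · exact .inr ⟨p, Set.mem_biUnion (⟨hv, hvC⟩ : v ∈ ℬ) hp, rfl⟩
    rcases hS _ _ hCan hBan hcov with h | h
    · exact h
    · obtain ⟨v, hv, hvj⟩ := j.exists_orthogonal_of_range_subset hM hℬT hℬact (hCS.trans h)
      refine absurd (fun p hp => ?_) hv.2
      rw [hrange]
      exact ⟨p, j.perp_subset_perp_columns hVW hT hv.1.2 hvj hp, rfl⟩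

end IntLattice

end

theorem mainTheorem7 (d : ℕ) (hd : 0 < d) (hd_even : Even d) :
    Nonempty (IntLattice.PrimitiveEmbedding (IntLattice.lambdaD d hd) IntLattice.lambdaSharp) ∧
    ∀ j : IntLattice.PrimitiveEmbedding (IntLattice.lambdaD d hd) IntLattice.lambdaSharp,
      ∃ T : Matrix (Fin 7) (Fin 7) ℚ, T.PosDef ∧ T.det = (d : ℚ) / 2 ^ 7 ∧
        IntLattice.lambdaSharp.IsIrreducibleComponent (Set.range j.periodMap)
          (IntLattice.lambdaSharp.specialCycle T 0) := by
  refine ⟨IntLattice.nonempty_primitiveEmbedding hd hd_even, fun j => ?_⟩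
  -- The ranks are `28 = 21 + 7`.
  obtain ⟨V, W, E, D, C, hV, hWV, hVW, hDC, u, hu, hdet⟩ := j.exists_orthogonal_basis (τ := Fin 7)
    (by simp) (by rw [IntLattice.lambdaSharp_det]; exact isUnit_one)
  obtain ⟨n₁, n₂, h₁, h₂, h₁₂⟩ := IntLattice.exists_negative_plane hd
  set S := Vᵀ * IntLattice.lambdaSharp.gram * V with hS
  have hSsymm : S.IsSymm := by
    rw [Matrix.IsSymm, hS, Matrix.transpose_mul, Matrix.transpose_mul, Matrix.transpose_transpose,
      IntLattice.lambdaSharp.isSymm, Matrix.mul_assoc]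
  obtain ⟨hpos, hSdet⟩ := IntLattice.posDef_map_real hSsymm fun x hx =>
    j.complement_pos IntLattice.lambdaSharp_posOnCodimTwo h₁ h₂ h₁₂ hV hWV hx
  have hSd : S.det = d := by
    rw [IntLattice.lambdaD_det] at hdet
    have hd' : (0 : ℤ) < d := by exact_mod_cast hd
    -- Both `d` and `det S` are positive, which excludes the sign `-1`.
    rcases Int.isUnit_iff.1 hu with rfl | rfl
    · linarith
    · linarith
  have hT := IntLattice.moment_columns IntLattice.lambdaSharp V
  have hTdet : (IntLattice.lambdaSharp.moment (IntLattice.columns V)).det = (d : ℚ) / 2 ^ 7 := by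
    rw [hT, Matrix.det_smul, ← RingHom.mapMatrix_apply, ← RingHom.map_det, ← hS, hSd]
    simp
    ring
  refine ⟨IntLattice.lambdaSharp.moment (IntLattice.columns V), ?_, hTdet,
    j.isIrreducibleComponent IntLattice.lambdaSharp_posOnCodimTwo hV hVW hDC ?_⟩
  · rw [hT]
    exact hpos.smul (by norm_num)
  · rw [hTdet]
    have : (0 : ℚ) < d := by exact_mod_cast hd
    positivity
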